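/- Setting. A threshold-based stochastic problem $\mathcal P$ is a family of instances; the sense (minimization or maximization) is fixed for $\mathcal P$. An instance consists of $n$ items, a support $\{a_1<\dots<a_k\}\subset\mathbb R$, a non-empty set $\mathcal C$ of feasible policies, a non-negative objective $f$, and an encoding of its known parameters as finite data. Item $i$ carries a random variable $X_i$ with values in $\{a_1,\dots,a_k\}$; $X_1,\dots,X_n$ are independent with distributions $\mathbf D=(\mathcal D_1,\dots,\mathcal D_n)$. A policy $\sigma$ is a decision tree whose inner nodes are labelled by pairs $(c,i)\in[k]\times[n]$ (probe item $i$ with threshold $a_c$), with two branches according to the observed bit $\mathbf 1[X_i\ge a_c]$; no item occurs twice on a root-leaf path. The objective $f(\sigma,\mathbf x)\ge 0$ depends only on the sequence of probed pairs and the realizations of the probed items. Put $f(\sigma\mid\mathbf D)=\mathbb E_{\mathbf x\sim\mathbf D}[f(\sigma,\mathbf x)]$, let $\mathrm{OPT}(\mathbf D)$ be the minimum (resp. maximum) of $f(\sigma\mid\mathbf D)$ over $\sigma\in\mathcal C$, and let $f_{\max}$ be the maximum of $f(\sigma,\mathbf x)$ over all $\sigma\in\mathcal C$ and all realizations $\mathbf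 x$. $\mathbf E$ stochastically dominates $\mathbf D$ if $\Pr_{\mathcal E_i}(X_i\ge r)\ge\Pr_{\mathcal D_i}(X_i\ge r)$ for all $i$ and all $r\in\mathbb R$. $\mathcal P$ is up-monotone (resp. down-monotone) if, for every instance, $\mathrm{OPT}(\mathbf E)\le\mathrm{OPT}(\mathbf D)$ (resp. $\mathrm{OPT}(\mathbf E)\ge\mathrm{OPT}(\mathbf D)$) whenever $\mathbf E$ stochastically dominates $\mathbf D$. An algorithm *carries out* a policy $\sigma$ if, at every state that $\sigma$ visits under some realization (a state is the sequence of pairs probed so far with the observed bits), it computes from its input and that state the next pair to probe, or the decision to stop, as prescribed by $\sigma$. An $\alpha$-approximation algorithm via threshold policies is given an instance and rational distributions $\mathbf D$ and carries out, in time polynomial in the size of its input (instance, distributions, state) per decision, a policy $\sigma\in\mathcal C$ with $f(\sigma\mid\mathbf D)\le\alpha\,\mathrm{OPT}(\mathbf D)$ for minimization (where $\alpha\ge 1$), resp. $f(\sigma\mid\mathbf D)\ge\alpha\,\mathrm{OPT}(\mathbf D)$ for maximization (where $0\le\alpha\le1$). In the online problem the distributions $\mathbf D$ are unknown and $\mathbf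 x^1,\dots,\mathbf x^T\sim\mathbf D$ are independent. In period $t$ a binary feedback learning algorithm, which knows the instance and $T$, carries out a policy $\sigma^t\in\mathcal C$ that depends only on the binary feedback of periods $1,\dots,t-1$, that is, on the pairs probed and the bits $\mathbf 1[x^s_i\ge a_c]$ observed there. Its $\alpha$-regret is $\mathbb E\big[\sum_{t=1}^T f(\sigma^t,\mathbf x^t)\big]-\alpha T\,\mathrm{OPT}(\mathbf D)$ for minimization and $\alpha T\,\mathrm{OPT}(\mathbf D)-\mathbb E\big[\sum_{t=1}^T f(\sigma^t,\mathbf x^t)\big]$ for maximization. Running times are bit costs. Theorem. There is an absolute constant $C>0$ such that the following holds. Let $\mathcal P$ be a threshold-based stochastic problem that is up-monotone or down-monotone and for which, for every feasible policy $\sigma$ of every instance, $f(\sigma,\cdot)$ is constant at each leaf of $\sigma$ (realizations that lead to the same leaf have the same objective value). Suppose that $\mathcal P$ has an $\alpha$-approximation algorithm via threshold policies. Then there is a binary feedback learning algorithm for $\mathcal P$, each of whose decisions takes time polynomial in $n$, $k$, $T$ and the size of the instance (hence so is its total running time over the $T$ periods), such that for every instance, every $T$ and all distributions $\mathbf D$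 on the support its $\alpha$-regret over $T$ periods is at most $$C\,n\,f_{\max}\sqrt{kT\log(knT)}.$$ -/

import Mathlib

/-! ## A model of computation with a step count

Data are binary trees with natural numbers (in binary) at the leaves; programs are built from
projections, pairing, composition, integer arithmetic, branching and unbounded loops.  Every
elementary operation is charged the bit size of the data it is applied to (logarithmic cost), so
that "cost polynomial in the input size" is the usual notion of polynomial time. -/

namespace BinaryFeedback

/-- Data: natural numbers and pairs. -/
inductive Val : Type
  | num (m : ℕ) : Val
  | pair (u v : Val) : Val

namespace Val

/-- Bit size of a piece of data. -/
def size : Val → ℕ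
  | num m => m.size + 1
  | pair u v => u.size + v.size + 1

/-- The number at a leaf (`0` for a pair). -/
def toNat : Val → ℕ
  | num m => m
  | pair _ _ => 0

/-- First component (`0` for a number). -/
def fst : Val → Val
  | num _ => num 0
  | pair u _ => u

/-- Second component (`0` for a number). -/
def snd : Val → Val
  | num _ => num 0
  | pair _ v => v

/-- Lists are right-nested pairs that end in `0`. -/
def ofList : List Val → Val
  | [] => num 0
  | v :: l => pair v (ofList l)

end Val

/-- Programs, each transforming one piece of data into another.  `add`, `sub` (truncated), `mul`
and `div` (integer division) act on a pair of numbers; `comp p q` is "first `q`, then `p`";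
`ite c p q` runs `p` if the value of `c` is not `0`, and `q` if it is; `loop c p` is
"while the value of `c` is not `0`, replace the data by the value of `p`". -/
inductive Prog : Type
  | id : Prog
  | const (w : Val) : Prog
  | fst : Prog
  | snd : Prog
  | add : Prog
  | sub : Prog
  | mul : Prog
  | div : Prog
  | pair (p q : Prog) : Prog
  | comp (p q : Prog) : Prog
  | ite (c p q : Prog) : Prog
  | loop (c p : Prog) : Prog

/-- `Runs p v w t`: program `p`, started on data `v`, halts with result `w` at total cost `t`. -/
inductive Runs : Prog → Val → Val → ℕ → Prop
  | id (v : Val) : Runs .id v v v.size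
  | const (w v : Val) : Runs (.const w) v w (v.size + w.size)
  | fst (v : Val) : Runs .fst v v.fst v.size
  | snd (v : Val) : Runs .snd v v.snd v.size
  | add (v : Val) : Runs .add v (.num (v.fst.toNat + v.snd.toNat)) v.size
  | sub (v : Val) : Runs .sub v (.num (v.fst.toNat - v.snd.toNat)) v.size
  | mul (v : Val) : Runs .mul v (.num (v.fst.toNat * v.snd.toNat)) v.size
  | div (v : Val) : Runs .div v (.num (v.fst.toNat / v.snd.toNat)) v.size
  | pair {p q : Prog} {v a b : Val} {s t : ℕ} :
      Runs p v a s → Runs q v b t → Runs (.pair p q) v (.pair a b) (s + t + 1)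
  | comp {p q : Prog} {v u w : Val} {s t : ℕ} :
      Runs q v u s → Runs p u w t → Runs (.comp p q) v w (s + t + 1)
  | ite_true {c p q : Prog} {v u w : Val} {s t : ℕ} :
      Runs c v u s → u ≠ .num 0 → Runs p v w t → Runs (.ite c p q) v w (s + t + 1)
  | ite_false {c p q : Prog} {v w : Val} {s t : ℕ} :
      Runs c v (.num 0) s → Runs q v w t → Runs (.ite c p q) v w (s + t + 1)
  | loop_stop {c p : Prog} {v : Val} {s : ℕ} :
      Runs c v (.num 0) s → Runs (.loop c p) v v (s + 1)
  | loop_step {c p : Prog} {v u v' w : Val} {s t r : ℕ} :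
      Runs c v u s → u ≠ .num 0 → Runs p v v' t → Runs (.loop c p) v' w r →
      Runs (.loop c p) v w (s + t + r + 1)

/-! ## Threshold policies -/

/-- A realization of the `n` random variables: `x i = j` means that item `i` takes the `j`-th
smallest value of the common support. -/
abbrev Realization (n k : ℕ) : Type := Fin n → Fin k

/-- A state of a policy under binary feedback: the sequence of probes made so far (item and index
of the threshold), each with the observed bit "value ≥ threshold". -/
abbrev Transcript (n k : ℕ) : Type := List (Fin n × Fin k × Bool)

/-- A threshold policy under binary feedback: a decision tree whose inner nodes are labelled by an
item and a threshold; the two branches correspond to "value ≥ threshold" and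
"value < threshold". -/
inductive DTree (n k : ℕ) : Type
  | leaf : DTree n k
  | probe (i : Fin n) (c : Fin k) (yes no : DTree n k) : DTree n k

namespace DTree

variable {n k : ℕ}

/-- No item of `used` is probed, and no item is probed twice on a root-leaf path. -/
def NoRepeat : DTree n k → Set (Fin n) → Prop
  | leaf, _ => True
  | probe i _ yes no, used =>
      i ∉ used ∧ yes.NoRepeat (insert i used) ∧ no.NoRepeat (insert i used)

/-- The probes and observed bits on the root-leaf path followed under realization `x`; it
identifies the leaf that is reached.  As the support values are indexed in increasing order,
"value of item `i` ≥ `c`-th support value" reads `c ≤ x i`. -/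
def transcript : DTree n k → Realization n k → Transcript n k
  | leaf, _ => []
  | probe i c yes no, x =>
      if c ≤ x i then (i, c, true) :: yes.transcript x else (i, c, false) :: no.transcript x

/-- `S(σ, x)`: the sequence of item-threshold pairs probed under realization `x`. -/
def probes (σ : DTree n k) (x : Realization n k) : List (Fin n × Fin k) :=
  (σ.transcript x).map fun s => (s.1, s.2.1)

/-- The states visited under realization `x`, each with the decision taken there:
the next item and threshold to probe, or `none` for stopping. -/
def trace : DTree n k → Realization n k → List (Transcript n k × Option (Fin n × Fin k))
  | leaf, _ => [([], none)]
  | probe i c yes no, x =>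
      ([], some (i, c)) ::
        if c ≤ x i then (yes.trace x).map fun s => ((i, c, true) :: s.1, s.2)
        else (no.trace x).map fun s => ((i, c, false) :: s.1, s.2)

end DTree

/-! ## Threshold-based stochastic problems -/

/-- An instance of a threshold-based stochastic problem: everything but the distributions. -/
structure Instance : Type where
  /-- the number of items -/
  n : ℕ
  /-- the size of the common support -/
  k : ℕ
  /-- the support values -/
  a : Fin k → ℝ
  a_strictMono : StrictMono a
  /-- the feasible policies -/
  feasible : Set (DTree n k)
  feasible_nonempty : feasible.Nonempty
  feasible_noRepeat : ∀ σ ∈ feasible, σ.NoRepeat ∅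
  /-- the objective value, from the sequence of probed pairs and the realization -/
  cost : List (Fin n × Fin k) → Realization n k → ℝ
  cost_nonneg : ∀ S x, 0 ≤ cost S x
  /-- the objective depends only on the realizations of the probed items -/
  cost_local : ∀ S x y, (∀ p ∈ S, x p.1 = y p.1) → cost S x = cost S y

/-- Minimization or maximization. -/
inductive Sense : Type
  | minimize : Sense
  | maximize : Sense

/-- A family `D` of `n` probability distributions on the `k` support values. -/
def IsDist {n k : ℕ} (D : Fin n → Fin k → ℝ) : Prop :=
  ∀ i, D i ∈ stdSimplex ℝ (Fin k)

/-- Probability of realization `x` when the items are independent with distributions `D i`. -/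
noncomputable def prob {n k : ℕ} (D : Fin n → Fin k → ℝ) (x : Realization n k) : ℝ :=
  ∏ i, D i (x i)

/-- The distributions given by non-negative integer weights. -/
noncomputable def ofWeights {n k : ℕ} (w : Fin n → Fin k → ℕ) : Fin n → Fin k → ℝ :=
  fun i j => (w i j : ℝ) / ((∑ j', w i j' : ℕ) : ℝ)

namespace Instance

variable (I : Instance)

/-- `f(σ, x)`. -/
def value (σ : DTree I.n I.k) (x : Realization I.n I.k) : ℝ :=
  I.cost (σ.probes x) x

/-- `f(σ | D)`: the expected objective of policy `σ` under `D`. -/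
noncomputable def expValue (D : Fin I.n → Fin I.k → ℝ) (σ : DTree I.n I.k) : ℝ :=
  ∑ x : Realization I.n I.k, prob D x * I.value σ x

/-- The optimal expected objective under `D`. -/
noncomputable def opt (D : Fin I.n → Fin I.k → ℝ) : Sense → ℝ
  | .minimize => ⨅ σ : I.feasible, I.expValue D σ
  | .maximize => ⨆ σ : I.feasible, I.expValue D σ

/-- The maximal value of the objective over all feasible policies and all realizations. -/
noncomputable def fMax : ℝ :=
  ⨆ p : I.feasible × Realization I.n I.k, I.value p.1 p.2

/-- `E` stochastically dominates `D`. -/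
def Dominates (E D : Fin I.n → Fin I.k → ℝ) : Prop :=
  ∀ i, ∀ r : ℝ, (∑ j, if r ≤ I.a j then D i j else 0) ≤ ∑ j, if r ≤ I.a j then E i j else 0

/-- At each leaf of a policy the objective is constant, that is, it is determined by the
binary feedback. -/
def LeafConstant : Prop :=
  ∀ σ ∈ I.feasible, ∀ x y, σ.transcript x = σ.transcript y → I.value σ x = I.value σ y

/-- The history, most recent period first, that arises when the policy of each period is obtained
from the feedback of the earlier periods by `rule`, and the realizations, most recent first,
are as listed. -/
def history (rule : List (Transcript I.n I.k) → DTree I.n I.k) :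
    List (Realization I.n I.k) → List (Transcript I.n I.k)
  | [] => []
  | x :: xs => (rule (history rule xs)).transcript x :: history rule xs

/-- The feedback received before period `t` (periods are counted from `0`), when the
realizations of the `T` periods are `xs`. -/
def historyBefore (rule : List (Transcript I.n I.k) → DTree I.n I.k) {T : ℕ}
    (xs : Fin T → Realization I.n I.k) (t : Fin T) : List (Transcript I.n I.k) :=
  I.history rule ((List.ofFn xs).take t).reverse

/-- The expected total objective over `T` periods with independent realizations under `D`. -/
noncomputable def expTotal (rule : List (Transcript I.n I.k) → DTree I.n I.k) (T : ℕ)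
    (D : Fin I.n → Fin I.k → ℝ) : ℝ :=
  ∑ xs : Fin T → Realization I.n I.k,
    (∏ t, prob D (xs t)) * ∑ t, I.value (rule (I.historyBefore rule xs t)) (xs t)

/-- The `α`-regret over `T` periods under `D`. -/
noncomputable def regret (sense : Sense) (α : ℝ)
    (rule : List (Transcript I.n I.k) → DTree I.n I.k) (T : ℕ) (D : Fin I.n → Fin I.k → ℝ) : ℝ :=
  match sense with
  | .minimize => I.expTotal rule T D - α * T * I.opt D .minimize
  | .maximize => α * T * I.opt D .maximize - I.expTotal rule T D

end Instance

/-! ## Encodings of inputs and outputs -/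

def encStep {n k : ℕ} (s : Fin n × Fin k × Bool) : Val :=
  .pair (.num s.1) (.pair (.num s.2.1) (.num (if s.2.2 then 1 else 0)))

def encTranscript {n k : ℕ} (s : Transcript n k) : Val :=
  Val.ofList (s.map encStep)

def encHistory {n k : ℕ} (h : List (Transcript n k)) : Val :=
  Val.ofList (h.map encTranscript)

def encDecision {n k : ℕ} : Option (Fin n × Fin k) → Val
  | none => .num 0
  | some p => .pair (.num p.1) (.num p.2)

def encWeights {n k : ℕ} (w : Fin n → Fin k → ℕ) : Val :=
  Val.ofList (List.ofFn fun i => Val.ofList (List.ofFn fun j => Val.num (w i j)))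

/-- Program `p` carries out policy `σ` with cost at most `B` per decision: under every
realization, at every state that is visited, `p` computes the decision of `σ` from the data
`input s` that it is given in state `s`. -/
def Implements {n k : ℕ} (p : Prog) (input : Transcript n k → Val) (σ : DTree n k)
    (B : Transcript n k → ℕ) : Prop :=
  ∀ x, ∀ s ∈ σ.trace x, ∃ t ≤ B s.1, Runs p (input s.1) (encDecision s.2) t

/-- A threshold-based stochastic problem: a family of instances, each with an encoding of its
known parameters as data. -/
structure ThresholdProblem : Type 1 where
  sense : Sense
  /-- the instances -/
  Inst : Type
  inst : Inst → Instance
  /-- the encoding of an instance -/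
  enc : Inst → Val

namespace ThresholdProblem

variable (P : ThresholdProblem)

/-- Approximation ratios are at least `1` for minimization and at most `1` for maximization. -/
def IsRatio (α : ℝ) : Prop :=
  match P.sense with
  | .minimize => 1 ≤ α
  | .maximize => 0 ≤ α ∧ α ≤ 1

def UpMonotone : Prop :=
  ∀ (I : P.Inst) (D E : Fin (P.inst I).n → Fin (P.inst I).k → ℝ), IsDist D → IsDist E →
    (P.inst I).Dominates E D → (P.inst I).opt E P.sense ≤ (P.inst I).opt D P.sense

def DownMonotone : Prop :=
  ∀ (I : P.Inst) (D E : Fin (P.inst I).n → Fin (P.inst I).k → ℝ), IsDist D → IsDist E →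
    (P.inst I).Dominates E D → (P.inst I).opt D P.sense ≤ (P.inst I).opt E P.sense

/-- The objective is determined by the binary feedback. -/
def LeafConstant : Prop := ∀ I, (P.inst I).LeafConstant

/-- Policy `σ` is an `α`-approximate solution of instance `I` with distributions `D`. -/
def IsApprox (I : P.Inst) (α : ℝ) (D : Fin (P.inst I).n → Fin (P.inst I).k → ℝ)
    (σ : DTree (P.inst I).n (P.inst I).k) : Prop :=
  match P.sense with
  | .minimize => (P.inst I).expValue D σ ≤ α * (P.inst I).opt D .minimize
  | .maximize => α * (P.inst I).opt D .maximize ≤ (P.inst I).expValue D σ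

/-- The input of an offline algorithm: the instance, the distributions (as integer weights, the
probabilities being the weights divided by their sum), and the current state of the policy. -/
def offlineInput (I : P.Inst) (w : Fin (P.inst I).n → Fin (P.inst I).k → ℕ)
    (s : Transcript (P.inst I).n (P.inst I).k) : Val :=
  .pair (P.enc I) (.pair (encWeights w) (encTranscript s))

/-- `alg` is a polynomial-time `α`-approximation algorithm via threshold policies: for each
instance and all (rational) distributions it carries out, in time polynomial in the input size,
a feasible `α`-approximate threshold policy. -/
def IsApproxAlgorithm (α : ℝ) (alg : Prog) : Prop :=
  ∃ b : Polynomial ℕ, ∀ (I : P.Inst) (w : Fin (P.inst I).n → Fin (P.inst I).k → ℕ),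
    (∀ i, 0 < ∑ j, w i j) →
    ∃ σ ∈ (P.inst I).feasible, P.IsApprox I α (ofWeights w) σ ∧
      Implements alg (P.offlineInput I w) σ fun s => b.eval (P.offlineInput I w s).size

/-- A learning rule: for each instance and number `T` of periods, the policy of the next period as
a function of the binary feedback of the earlier periods (most recent first).  The distributions
are not available to it. -/
abbrev LearningRule : Type :=
  ∀ (I : P.Inst) (_T : ℕ),
    List (Transcript (P.inst I).n (P.inst I).k) → DTree (P.inst I).n (P.inst I).k

/-- The input of a learning algorithm at the time of a decision: the instance, the numbers `n`,
`k` and `T`, the feedback of the earlier periods, and the feedback of the current period. -/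
def onlineInput (I : P.Inst) (T : ℕ) (h : List (Transcript (P.inst I).n (P.inst I).k))
    (s : Transcript (P.inst I).n (P.inst I).k) : Val :=
  .pair (P.enc I) (.pair (.pair (.num (P.inst I).n) (.pair (.num (P.inst I).k) (.num T)))
    (.pair (encHistory h) (encTranscript s)))

/-- `learner` is a polynomial-time learning algorithm that follows `rule`: in each of the `T`
periods, whatever the realizations are, it carries out the feasible policy chosen by `rule`, and
each decision takes time polynomial in `n`, `k`, `T` and the size of the instance.  (There are at
most `(n + 1) T` decisions, so the total time is polynomial too.) -/
def IsPolyTimeLearner (learner : Prog) (rule : P.LearningRule) : Prop :=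
  ∃ b : Polynomial ℕ, ∀ (I : P.Inst) (T : ℕ)
    (xs : Fin T → Realization (P.inst I).n (P.inst I).k) (t : Fin T),
    rule I T ((P.inst I).historyBefore (rule I T) xs t) ∈ (P.inst I).feasible ∧
    Implements learner (P.onlineInput I T ((P.inst I).historyBefore (rule I T) xs t))
      (rule I T ((P.inst I).historyBefore (rule I T) xs t))
      fun _ => b.eval ((P.inst I).n + (P.inst I).k + T + (P.enc I).size)

end ThresholdProblem

end BinaryFeedback

open BinaryFeedback

namespace BinaryFeedback

/-! ## Polynomially bounded computations -/

section Computations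

variable {ι κ : Type*}

/-! The learner is optimistic. For each pair of an item and a threshold it keeps an empirical
frequency with a confidence radius, and turns these into tail probabilities that, with high
probability, all overestimate or all underestimate the true ones; the direction depends on the sense
and on the kind of monotonicity. A running minimum over the thresholds whose bounds apply makes the
estimated tails monotone, so they belong to genuine distributions E. Rounding to multiples of 1/T
keeps the weights integral and small. In each period the offline algorithm is followed on E.

Monotonicity makes OPT(E) at least as good as OPT(D), so an α-approximate policy σ for E misses α
OPT(D) by at most |f(σ|D) - f(σ|E)| (`loss_le_of_better`). The objective is a function of the leaf
and no item is repeated on a path, so both values are expectations over a tree with independent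
bits. Exchanging the bit probabilities node by node costs at most f_max times the tail errors of the
probes on the path followed under the true D (`DTree.abs_expect_sub_le`). Hence only errors at pairs
that are really probed count, and these are the pairs about which data are gathered.

After N observations the error is of order √(L/N) with L about log(knT), which is dominated by the
growth of a potential Σ √(LN). Telescoping, and Cauchy–Schwarz for at most nT observations spread
over nk pairs, give n√(kTL) (`sum_histExpect_estError_le`). Failure of the confidence bounds is
controlled by an exponential supermartingale (`histExpect_exp_deviation_le`) and a union bound; its
total cost is at most 2 f_max.

As to time, the learned weights depend only on completed periods. Recomputing them at each decision
and handing them to the offline program, with the current state, therefore carries out one fixed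
policy per period. The relation `Computes` tracks polynomial cost through pairing, arithmetic,
branching and bounded loops (`LearnerState.exists_learner`). -/

theorem Val.toNat_add_one_size_le (v : Val) : v.toNat.size + 1 ≤ v.size := by
  cases v with
  | num m => simp [Val.toNat, Val.size]
  | pair u v => simp [Val.toNat, Val.size]

theorem Val.fst_size_le (v : Val) : v.fst.size ≤ v.size := by
  cases v <;> simp [Val.fst, Val.size]; omega

theorem Val.snd_size_le (v : Val) : v.snd.size ≤ v.size := by
  cases v <;> simp [Val.snd, Val.size]; omega

theorem Val.fst_toNat_snd_toNat_size_le (v : Val) :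
    v.fst.toNat.size + v.snd.toNat.size + 1 ≤ v.size := by
  cases v with
  | num m => simp [Val.fst, Val.snd, Val.toNat, Val.size]
  | pair a b =>
    have := a.toNat_add_one_size_le
    have := b.toNat_add_one_size_le
    simp only [Val.fst, Val.snd, Val.size]; omega

theorem natSize_add_le (a b : ℕ) : (a + b).size ≤ a.size + b.size + 1 := by
  rw [Nat.size_le]
  have ha := Nat.lt_size_self a
  have hb := Nat.lt_size_self b
  have h1 : 2 ^ a.size ≤ 2 ^ (a.size + b.size) := Nat.pow_le_pow_right (by norm_num) (by omega)
  have h2 : 2 ^ b.size ≤ 2 ^ (a.size + b.size) := Nat.pow_le_pow_right (by norm_num) (by omega)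
  rw [pow_succ]; omega

theorem natSize_mul_le (a b : ℕ) : (a * b).size ≤ a.size + b.size := by
  rw [Nat.size_le, pow_add]
  exact Nat.mul_lt_mul'' (Nat.lt_size_self a) (Nat.lt_size_self b)

theorem natSize_le_self (a : ℕ) : a.size ≤ a := by
  rw [Nat.size_le]; exact Nat.lt_two_pow_self

/-- The cost of a computation bounds the size of its input and the size of its output up to a
factor of two. -/
theorem Runs.size_le {p : Prog} {v w : Val} {t : ℕ} (h : Runs p v w t) :
    v.size ≤ t ∧ w.size ≤ 2 * t := by
  induction h with
  | id v => omega
  | const w v => omega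
  | fst v => have := v.fst_size_le; omega
  | snd v => have := v.snd_size_le; omega
  | add v =>
    have := v.fst_toNat_snd_toNat_size_le
    have := natSize_add_le v.fst.toNat v.snd.toNat
    simp only [Val.size]; omega
  | sub v =>
    have := v.fst_toNat_snd_toNat_size_le
    have := Nat.size_le_size (Nat.sub_le v.fst.toNat v.snd.toNat)
    simp only [Val.size]; omega
  | mul v =>
    have := v.fst_toNat_snd_toNat_size_le
    have := natSize_mul_le v.fst.toNat v.snd.toNat
    simp only [Val.size]; omega
  | div v =>
    have := v.fst_toNat_snd_toNat_size_le
    have := Nat.size_le_size (Nat.div_le_self v.fst.toNat v.snd.toNat)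
    simp only [Val.size]; omega
  | pair _ _ ih1 ih2 => simp only [Val.size]; omega
  | comp _ _ ih1 ih2 => omega
  | ite_true _ _ _ ih1 ih2 => omega
  | ite_false _ _ ih1 ih2 => omega
  | loop_stop _ ih => omega
  | loop_step _ _ _ _ ih1 ih2 ih3 => omega

theorem polynomial_eval_mono (b : Polynomial ℕ) : Monotone fun m : ℕ => b.eval m := by
  intro x y h
  simp only [Polynomial.eval_eq_sum_range]
  exact Finset.sum_le_sum fun j _ => Nat.mul_le_mul_left _ (Nat.pow_le_pow_left h j)

/-- `g` is bounded by a polynomial in `μ`. -/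
def PolyBdd (μ g : ι → ℕ) : Prop := ∃ b : Polynomial ℕ, ∀ i, g i ≤ b.eval (μ i)

namespace PolyBdd

variable {μ g h : ι → ℕ}

theorem mono (hh : PolyBdd μ h) (H : ∀ i, g i ≤ h i) : PolyBdd μ g :=
  let ⟨b, hb⟩ := hh
  ⟨b, fun i => (H i).trans (hb i)⟩

theorem const (c : ℕ) : PolyBdd μ (fun _ => c) := ⟨Polynomial.C c, by simp⟩

theorem self : PolyBdd μ μ := ⟨Polynomial.X, by simp⟩

theorem add (hg : PolyBdd μ g) (hh : PolyBdd μ h) : PolyBdd μ (fun i => g i + h i) :=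
  let ⟨b, hb⟩ := hg
  let ⟨c, hc⟩ := hh
  ⟨b + c, fun i => by rw [Polynomial.eval_add]; exact Nat.add_le_add (hb i) (hc i)⟩

theorem mul (hg : PolyBdd μ g) (hh : PolyBdd μ h) : PolyBdd μ (fun i => g i * h i) :=
  let ⟨b, hb⟩ := hg
  let ⟨c, hc⟩ := hh
  ⟨b * c, fun i => by rw [Polynomial.eval_mul]; exact Nat.mul_le_mul (hb i) (hc i)⟩

theorem reindex (r : κ → ι) (hg : PolyBdd μ g) :
    PolyBdd (fun q => μ (r q)) (fun q => g (r q)) :=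
  let ⟨b, hb⟩ := hg
  ⟨b, fun q => hb (r q)⟩

theorem eval (b : Polynomial ℕ) (hg : PolyBdd μ g) : PolyBdd μ (fun i => b.eval (g i)) :=
  let ⟨c, hc⟩ := hg
  ⟨b.comp c, fun _ => by
    rw [Polynomial.eval_comp]
    exact polynomial_eval_mono b (hc _)⟩

theorem size_num (hg : PolyBdd μ g) : PolyBdd μ (fun i => (Val.num (g i)).size) :=
  (hg.add (const 1)).mono fun _ => Nat.add_le_add_right (natSize_le_self _) 1

theorem size_pair {u v : ι → Val} (hu : PolyBdd μ fun i => (u i).size)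
    (hv : PolyBdd μ fun i => (v i).size) : PolyBdd μ fun i => (Val.pair (u i) (v i)).size :=
  (hu.add hv).add (const 1)

end PolyBdd

/-- Some program computes `f i` from `e i` for all `i`, at a cost that is polynomial in `μ i`. -/
def Computes (μ : ι → ℕ) (e f : ι → Val) : Prop :=
  ∃ (p : Prog) (τ : ι → ℕ), PolyBdd μ τ ∧ ∀ i, Runs p (e i) (f i) (τ i)

/-- The pairs of an index `i` and a natural number below `l i`. -/
abbrev Below (l : ι → ℕ) : Type _ := {q : ι × ℕ // q.2 < l q.1}

namespace Computes

variable {μ : ι → ℕ} {e f g h : ι → Val} {a b : ι → ℕ}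

/-- A run pays for reading its input and for its output, so `Computes` already contains the size
bounds that later constructions need. -/
theorem size_left (H : Computes μ e f) : PolyBdd μ fun i => (e i).size :=
  let ⟨_, _, hτ, hr⟩ := H
  hτ.mono fun i => (hr i).size_le.1

theorem size_right (H : Computes μ e f) : PolyBdd μ fun i => (f i).size :=
  let ⟨_, _, hτ, hr⟩ := H
  ((PolyBdd.const 2).mul hτ).mono fun i => (hr i).size_le.2

theorem of_le (p : Prog) {τ : ι → ℕ} (hτ : PolyBdd μ τ)
    (H : ∀ i, ∃ t ≤ τ i, Runs p (e i) (f i) t) : Computes μ e f := by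
  choose t ht hr using H
  exact ⟨p, t, hτ.mono ht, hr⟩

theorem congr (H : Computes μ e f) (hfg : ∀ i, f i = g i) : Computes μ e g :=
  (funext hfg : f = g) ▸ H

theorem reindex (r : κ → ι) (H : Computes μ e f) :
    Computes (fun q => μ (r q)) (fun q => e (r q)) (fun q => f (r q)) :=
  let ⟨p, _, hτ, hr⟩ := H
  ⟨p, _, hτ.reindex r, fun q => hr (r q)⟩

theorem refl (he : PolyBdd μ fun i => (e i).size) : Computes μ e e :=
  ⟨.id, _, he, fun i => .id (e i)⟩

theorem trans (H : Computes μ e f) (H' : Computes μ f g) : Computes μ e g :=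
  let ⟨_, _, hτ, hr⟩ := H
  let ⟨_, _, hτ', hr'⟩ := H'
  ⟨.comp _ _, _, (hτ.add hτ').add (.const 1), fun i => .comp (hr i) (hr' i)⟩

theorem pair (H : Computes μ e f) (H' : Computes μ e g) :
    Computes μ e fun i => .pair (f i) (g i) :=
  let ⟨_, _, hτ, hr⟩ := H
  let ⟨_, _, hτ', hr'⟩ := H'
  ⟨.pair _ _, _, (hτ.add hτ').add (.const 1), fun i => .pair (hr i) (hr' i)⟩

theorem fst (H : Computes μ e fun i => .pair (f i) (g i)) : Computes μ e f :=
  H.trans ⟨.fst, _, H.size_right, fun i => .fst (.pair (f i) (g i))⟩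

theorem snd (H : Computes μ e fun i => .pair (f i) (g i)) : Computes μ e g :=
  H.trans ⟨.snd, _, H.size_right, fun i => .snd (.pair (f i) (g i))⟩

theorem const (he : PolyBdd μ fun i => (e i).size) (w : Val) : Computes μ e fun _ => w :=
  ⟨.const w, _, he.add (.const w.size), fun i => .const w (e i)⟩

theorem add (H : Computes μ e fun i => .num (a i)) (H' : Computes μ e fun i => .num (b i)) :
    Computes μ e fun i => .num (a i + b i) :=
  (H.pair H').trans ⟨.add, _, (H.pair H').size_right, fun _ => .add (.pair _ _)⟩

theorem sub (H : Computes μ e fun i => .num (a i)) (H' : Computes μ e fun i => .num (b i)) :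
    Computes μ e fun i => .num (a i - b i) :=
  (H.pair H').trans ⟨.sub, _, (H.pair H').size_right, fun _ => .sub (.pair _ _)⟩

theorem mul (H : Computes μ e fun i => .num (a i)) (H' : Computes μ e fun i => .num (b i)) :
    Computes μ e fun i => .num (a i * b i) :=
  (H.pair H').trans ⟨.mul, _, (H.pair H').size_right, fun _ => .mul (.pair _ _)⟩

theorem div (H : Computes μ e fun i => .num (a i)) (H' : Computes μ e fun i => .num (b i)) :
    Computes μ e fun i => .num (a i / b i) :=
  (H.pair H').trans ⟨.div, _, (H.pair H').size_right, fun _ => .div (.pair _ _)⟩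

theorem ite (Hc : Computes μ e fun i => .num (a i)) (H : Computes μ e f) (H' : Computes μ e g) :
    Computes μ e fun i => if a i = 0 then f i else g i := by
  obtain ⟨c, γ, hγ, hc⟩ := Hc
  obtain ⟨p, τ, hτ, hr⟩ := H
  obtain ⟨p', τ', hτ', hr'⟩ := H'
  refine of_le (.ite c p' p) (((hγ.add hτ).add hτ').add (.const 1)) fun i => ?_
  by_cases ha : a i = 0
  · have h0 := hc i
    simp only [ha] at h0
    rw [if_pos ha]
    exact ⟨_, by omega, .ite_false h0 (hr i)⟩
  · rw [if_neg ha]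
    exact ⟨_, by omega, .ite_true (hc i) (fun h => ha (Val.num.inj h)) (hr' i)⟩

theorem ite_num {c d : ι → ℕ} (Hc : Computes μ e fun i => .num (a i))
    (H : Computes μ e fun i => .num (c i)) (H' : Computes μ e fun i => .num (d i)) :
    Computes μ e fun i => .num (if a i = 0 then c i else d i) :=
  (Hc.ite H H').congr fun i => by split_ifs <;> rfl

theorem min (H : Computes μ e fun i => .num (a i)) (H' : Computes μ e fun i => .num (b i)) :
    Computes μ e fun i => .num (Min.min (a i) (b i)) :=
  -- With truncated subtraction, a - (a - b) is the minimum of a and b.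
  (H.sub (H.sub H')).congr fun i => by congr 1; omega

/-- While loops: `s i j` is the state after `j` rounds and `c i j` the value of the condition. -/
theorem loop {l : ι → ℕ} {s c : ι → ℕ → Val} (hl : PolyBdd μ l)
    (hc : Computes (fun q : Below fun i => l i + 1 => μ q.1.1) (fun q => s q.1.1 q.1.2)
      fun q => c q.1.1 q.1.2)
    (hc' : ∀ i j, j ≤ l i → (c i j = .num 0 ↔ l i ≤ j))
    (hs : Computes (fun q : Below l => μ q.1.1) (fun q => s q.1.1 q.1.2)
      fun q => s q.1.1 (q.1.2 + 1)) :
    Computes μ (fun i => s i 0) fun i => s i (l i) := by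
  obtain ⟨pc, γ, ⟨bγ, hγ⟩, hrc⟩ := hc
  obtain ⟨p, τ, ⟨bτ, hτ⟩, hr⟩ := hs
  -- Induction on the number m of rounds still to run. The cost of a round is bounded by polynomials
  -- in `μ i` alone, independent of the round; the factor m + 1 accounts for the last, failing test
  -- of the condition.
  have key : ∀ i m, m ≤ l i → ∃ t ≤ (m + 1) * (bγ.eval (μ i) + bτ.eval (μ i) + 1),
      Runs (.loop pc p) (s i (l i - m)) (s i (l i)) t := by
    intro i m
    induction m with
    | zero =>
      intro _
      have h0 := hrc ⟨(i, l i), by simp⟩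
      simp only [(hc' i (l i) le_rfl).2 le_rfl] at h0
      refine ⟨_, ?_, Runs.loop_stop h0⟩
      have := hγ ⟨(i, l i), by simp⟩
      simp only at this
      omega
    | succ m ih =>
      intro hm
      obtain ⟨t, ht, ht'⟩ := ih (by omega)
      have hj : l i - (m + 1) < l i := by omega
      have h1 := hrc ⟨(i, l i - (m + 1)), by simp⟩
      have h2 := hr ⟨(i, l i - (m + 1)), hj⟩
      have e1 := hγ ⟨(i, l i - (m + 1)), by simp⟩
      have e2 := hτ ⟨(i, l i - (m + 1)), hj⟩
      simp only [show l i - (m + 1) + 1 = l i - m by omega] at h1 h2 e1 e2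
      refine ⟨_, ?_, .loop_step h1 (fun h0 => ?_) h2 ht'⟩
      · rw [Nat.succ_mul]; omega
      · have := (hc' i _ hj.le).1 h0
        omega
  refine of_le (.loop pc p) (τ := fun i => (l i + 1) * (bγ.eval (μ i) + bτ.eval (μ i) + 1))
    ((hl.add (.const 1)).mul (((PolyBdd.self.eval bγ).add (PolyBdd.self.eval bτ)).add (.const 1)))
    fun i => ?_
  have := key i (l i) le_rfl
  rwa [Nat.sub_self] at this

/-- Used inside loops: what is computable from the outer data stays computable when a counter, an
accumulator or a list member is paired with it. -/
theorem lift {r : κ → ι} {z : κ → Val} (H : Computes μ e f)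
    (hz : PolyBdd (fun q => μ (r q)) fun q => (z q).size) :
    Computes (fun q => μ (r q)) (fun q => .pair (e (r q)) (z q)) fun q => f (r q) :=
  (fst (refl ((H.size_left.reindex r).size_pair hz))).trans (H.reindex r)

/-- Primitive recursion with a polynomially bounded number of rounds. -/
theorem natRec {l : ι → ℕ} {s : ι → ℕ → Val} (hlb : PolyBdd μ l)
    (hl : Computes μ e fun i => .num (l i)) (h0 : Computes μ e fun i => s i 0)
    (hs : Computes (fun q : Below l => μ q.1.1)
      (fun q => .pair (e q.1.1) (.pair (.num q.1.2) (s q.1.1 q.1.2)))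
      fun q => s q.1.1 (q.1.2 + 1)) :
    Computes μ e fun i => s i (l i) := by
  -- Sizes cannot accumulate over the rounds: each state after the initial one is the output of a
  -- step whose cost is polynomial in `μ` uniformly in the round.
  have hsz : PolyBdd (fun q : Below fun i => l i + 1 => μ q.1.1)
      fun q => (s q.1.1 q.1.2).size := by
    obtain ⟨b, hb⟩ := h0.size_right
    obtain ⟨c, hc⟩ := hs.size_right
    refine ⟨b + c, ?_⟩
    rintro ⟨⟨i, j⟩, hj⟩
    rw [Polynomial.eval_add]
    cases j with
    | zero => exact (hb i).trans (Nat.le_add_right _ _)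
    | succ j => exact (hc ⟨(i, j), Nat.lt_of_succ_lt_succ hj⟩).trans (Nat.le_add_left _ _)
  have hj : PolyBdd (fun q : Below fun i => l i + 1 => μ q.1.1) fun q => q.1.2 :=
    (hlb.reindex _).mono fun q => Nat.le_of_lt_succ q.2
  have he : PolyBdd (fun q : Below fun i => l i + 1 => μ q.1.1) fun q =>
      (Val.pair (e q.1.1) (.pair (.num q.1.2) (s q.1.1 q.1.2))).size :=
    (h0.size_left.reindex _).size_pair (hj.size_num.size_pair hsz)
  -- The loop state carries the original input and a counter j along with `s i j`; the condition
  -- recomputes the bound and tests whether l - j vanishes.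
  have hrec := loop (μ := μ) (l := l)
    (s := fun i j => .pair (e i) (.pair (.num j) (s i j))) (c := fun i j => .num (l i - j)) hlb
    ((hl.lift (hj.size_num.size_pair hsz)).sub (fst (snd (refl he))))
    (fun i j hj => by rw [Val.num.injEq]; omega)
    (by
      have he' := hs.size_left
      exact (fst (refl he')).pair (((fst (snd (refl he'))).add (const he' (.num 1))).pair hs))
  have hinit : Computes μ e fun i => .pair (e i) (.pair (.num 0) (s i 0)) :=
    (refl h0.size_left).pair ((const h0.size_left _).pair h0)
  exact snd (snd (hinit.trans hrec))

theorem _root_.BinaryFeedback.Val.length_le_size_ofList (L : List Val) :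
    L.length ≤ (Val.ofList L).size := by
  induction L with
  | nil => simp
  | cons v L ih => simp only [Val.ofList, Val.size, List.length_cons]; omega

theorem _root_.BinaryFeedback.Val.size_ofList_drop_le (L : List Val) (j : ℕ) :
    (Val.ofList (L.drop j)).size ≤ (Val.ofList L).size := by
  induction L generalizing j with
  | nil => simp
  | cons v L ih =>
    cases j with
    | zero => simp
    | succ j => have := ih j; simp only [Val.ofList, Val.size, List.drop_succ_cons]; omega

theorem _root_.BinaryFeedback.Val.size_ofList_le (L : List Val) (B : ℕ)
    (h : ∀ v ∈ L, v.size ≤ B) : (Val.ofList L).size ≤ L.length * (B + 1) + 1 := by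
  induction L with
  | nil => simp [Val.ofList, Val.size]
  | cons v L ih =>
    have h1 := h v (by simp)
    have h2 := ih fun w hw => h w (by simp [hw])
    simp only [Val.ofList, Val.size, List.length_cons, Nat.succ_mul]; omega

/-- The sum of a polynomially bounded computable function over the members of a list. -/
theorem listSum {α : ι → Type*} {L : ∀ i, List (α i)} {enc : ∀ i, α i → Val}
    {m : ∀ i, α i → ℕ} (hL : Computes μ e fun i => .ofList ((L i).map (enc i)))
    (hm : Computes (fun q : (i : ι) × {x // x ∈ L i} => μ q.1)
      (fun q => .pair (e q.1) (enc q.1 q.2.1)) fun q => .num (m q.1 q.2.1))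
    (hb : PolyBdd (fun q : (i : ι) × {x // x ∈ L i} => μ q.1) fun q => m q.1 q.2.1) :
    Computes μ e fun i => .num ((L i).map (m i)).sum := by
  have he := hL.size_left
  have hlen : PolyBdd μ fun i => (L i).length :=
    hL.size_right.mono fun i => by
      simpa using Val.length_le_size_ofList ((L i).map (enc i))
  have hsum : PolyBdd μ fun i => ((L i).map (m i)).sum := by
    obtain ⟨b, hb⟩ := hb
    refine (hlen.mul (.eval b .self)).mono fun i => ?_
    have := List.sum_le_card_nsmul ((L i).map (m i)) (b.eval (μ i)) fun x hx => by
      obtain ⟨y, hy, rfl⟩ := List.mem_map.1 hx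
      exact hb ⟨i, y, hy⟩
    simpa using this
  let S : ι → ℕ → Val := fun i j => .pair (e i)
    (.pair (.ofList (((L i).drop j).map (enc i))) (.num (((L i).take j).map (m i)).sum))
  have hS : PolyBdd (fun q : ι × ℕ => μ q.1) fun q => (S q.1 q.2).size := by
    refine (he.reindex Prod.fst).size_pair (PolyBdd.size_pair ?_ (PolyBdd.size_num ?_))
    · refine (hL.size_right.reindex Prod.fst).mono fun q => ?_
      rw [List.map_drop]
      exact Val.size_ofList_drop_le _ _
    · refine (hsum.reindex Prod.fst).mono fun q => ?_
      conv_rhs => rw [← List.take_append_drop q.2 (L q.1), List.map_append, List.sum_append]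
      exact Nat.le_add_right _ _
  -- The remaining list is itself the loop condition: its encoding is `num 0` exactly when it is
  -- empty.
  have hrec := loop (μ := μ) (l := fun i => (L i).length) (s := S)
    (c := fun i j => .ofList (((L i).drop j).map (enc i))) hlen
    (fst (snd (refl (hS.reindex fun q : Below fun i => (L i).length + 1 => q.1))))
    (fun i j hj => by
      rw [← List.drop_eq_nil_iff]
      cases (L i).drop j <;> simp [Val.ofList])
    (by
      have hS' := hS.reindex fun q : Below fun i => (L i).length => q.1
      have hdrop : ∀ q : Below fun i => (L i).length,
          Val.ofList (((L q.1.1).drop q.1.2).map (enc q.1.1)) =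
            .pair (enc q.1.1 ((L q.1.1).get ⟨q.1.2, q.2⟩))
              (.ofList (((L q.1.1).drop (q.1.2 + 1)).map (enc q.1.1))) := fun q => by
        rw [List.drop_eq_getElem_cons q.2]; rfl
      have h1 := (fst (snd (refl hS'))).congr hdrop
      have h2 := ((fst (refl hS')).pair h1.fst).trans
        (hm.reindex fun q : Below fun i => (L i).length =>
          ⟨q.1.1, ((L q.1.1).get ⟨q.1.2, q.2⟩), List.get_mem _ _⟩)
      refine ((fst (refl hS')).pair (h1.snd.pair ((snd (snd (refl hS'))).add h2))).congr fun q => ?_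
      simp only [S]
      rw [List.take_add_one, List.getElem?_eq_getElem q.2, List.map_append, List.sum_append]
      simp)
  have hinit : Computes μ e fun i => S i 0 := by
    refine ((refl he).pair (hL.pair (const he (.num 0)))).congr fun i => ?_
    simp [S]
  refine (snd (snd (hinit.trans hrec))).congr fun i => ?_
  rw [List.take_length]

/-- The list of the values of a computable function at the numbers below a bound. -/
theorem tabulate {l : ι → ℕ} {g : ι → ℕ → Val} (hlb : PolyBdd μ l)
    (hl : Computes μ e fun i => .num (l i))
    (hg : Computes (fun q : Below l => μ q.1.1) (fun q => .pair (e q.1.1) (.num q.1.2))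
      fun q => g q.1.1 q.1.2) :
    Computes μ e fun i => .ofList ((List.range (l i)).map (g i)) := by
  have he := hl.size_left
  -- Lists grow at the head, so the table is filled from its end: after j rounds it holds the values
  -- at the last j indices.
  let s : ι → ℕ → Val := fun i j => .ofList ((List.range' (l i - j) j).map (g i))
  have hs : PolyBdd (fun q : Below l => μ q.1.1) fun q => (s q.1.1 q.1.2).size := by
    obtain ⟨b, hb⟩ := hg.size_right
    refine ((hlb.mul ((PolyBdd.eval b .self).add (.const 1))).add (.const 1)).reindex
      (fun q : Below l => q.1.1) |>.mono fun q => ?_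
    refine (Val.size_ofList_le _ (b.eval (μ q.1.1)) fun v hv => ?_).trans ?_
    · obtain ⟨j, hj, rfl⟩ := List.mem_map.1 hv
      have hq := q.2
      rw [List.mem_range'_1] at hj
      exact hb ⟨(q.1.1, j), by simp only; omega⟩
    · rw [List.length_map, List.length_range']
      exact Nat.add_le_add_right (Nat.mul_le_mul_right _ q.2.le) _
  have hj : PolyBdd (fun q : Below l => μ q.1.1) fun q => q.1.2 :=
    (hlb.reindex _).mono fun q => q.2.le
  have hE : PolyBdd (fun q : Below l => μ q.1.1) fun q =>
      (Val.pair (e q.1.1) (.pair (.num q.1.2) (s q.1.1 q.1.2))).size :=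
    (he.reindex _).size_pair (hj.size_num.size_pair hs)
  have hlift := hl.lift (r := fun q : Below l => q.1.1) (hj.size_num.size_pair hs)
  have hidx : Computes (fun q : Below l => μ q.1.1)
      (fun q => .pair (e q.1.1) (.pair (.num q.1.2) (s q.1.1 q.1.2)))
      fun q => .num (l q.1.1 - (q.1.2 + 1)) :=
    hlift.sub ((fst (snd (refl hE))).add (const hE (.num 1)))
  have hval := ((fst (refl hE)).pair hidx).trans
    (hg.reindex fun q : Below l => ⟨(q.1.1, l q.1.1 - (q.1.2 + 1)), by
      have := q.2
      simp only
      omega⟩)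
  refine (natRec (s := s) hlb hl ((const he (.num 0)).congr fun i => ?_)
    ((hval.pair (snd (snd (refl hE)))).congr fun q => ?_)).congr fun i => ?_
  · simp [s, Val.ofList]
  · have hq := q.2
    simp only [s]
    rw [List.range'_succ, show l q.1.1 - (q.1.2 + 1) + 1 = l q.1.1 - q.1.2 by omega]
    rfl
  · simp only [s, Nat.sub_self, List.range_eq_range']

end Computes

end Computations

/-! ## Optimistic estimates from binary feedback, and a program that computes them -/

/-- The number of times that the probe of item `i` with threshold `c` had outcome `b` in a
period with feedback `s`. -/
def transcriptCount {n k : ℕ} (i c : ℕ) (b : Bool) (s : Transcript n k) : ℕ :=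
  (s.map fun x => if (x.1 : ℕ) = i ∧ (x.2.1 : ℕ) = c ∧ x.2.2 = b then 1 else 0).sum

/-- The number of times that the probe of item `i` with threshold `c` had outcome `b`. -/
def stepCount {n k : ℕ} (i c : ℕ) (b : Bool) (h : List (Transcript n k)) : ℕ :=
  (h.map (transcriptCount i c b)).sum

/-- The number of times that item `i` was probed with threshold `c`. -/
def probeCount {n k : ℕ} (i c : ℕ) (h : List (Transcript n k)) : ℕ :=
  stepCount i c true h + stepCount i c false h

/-- Confidence radius, in units of one observation, after `N` observations. -/
def radius (L N : ℕ) : ℕ := Nat.sqrt (8 * L * N) + 1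

/-- Upper confidence bound, in units of `1 / T`, after `H` hits in `N` observations. -/
def upperEst (T L N H : ℕ) : ℕ := if N = 0 then T else T * (H + radius L N) / N + 1

/-- The minimum of `T` and of the `U j` with `j < m` and `rel j ≠ 0`. -/
def runningMin (T : ℕ) (rel U : ℕ → ℕ) : ℕ → ℕ
  | 0 => T
  | m + 1 => if rel m = 0 then runningMin T rel U m else min (runningMin T rel U m) (U m)

/-- Nonzero if the estimate at threshold `j` is a bound on the tail probability at threshold `c`,
by monotonicity: for upper bounds (`dir = true`) if `1 ≤ j ≤ c`, for lower bounds if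
`1 ≤ j` and `c ≤ j`. -/
def relevant (dir : Bool) (c j : ℕ) : ℕ := j * (if dir then c + 1 - j else j + 1 - c)

/-- Upper confidence bound on the probability that the bit observed when item `i` is probed with
threshold `c` is `dir`. -/
def bitEst (dir : Bool) {n k : ℕ} (T : ℕ) (h : List (Transcript n k)) (i c : ℕ) : ℕ :=
  upperEst T (Nat.clog 2 (k * n * T)) (probeCount i c h) (stepCount i c dir h)

/-- The monotone upper (`dir = true`) or lower (`dir = false`) estimate, in units of `1 / T`, of
the probability that item `i` is at least the `c`-th support value. -/
def tailEst (dir : Bool) {n k : ℕ} (T : ℕ) (h : List (Transcript n k)) (i c : ℕ) : ℕ :=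
  if c = 0 then T else if k - c = 0 then 0 else
    if dir then runningMin T (relevant dir c) (bitEst dir T h i) k
    else T - runningMin T (relevant dir c) (bitEst dir T h i) k

/-- The weights of the distributions whose tails are the monotone estimates. -/
def learnedWeights (dir : Bool) {n k : ℕ} (T : ℕ) (h : List (Transcript n k)) :
    Fin n → Fin k → ℕ :=
  fun i c => tailEst dir T h i c - tailEst dir T h i (c + 1)

theorem transcriptCount_le_length {n k : ℕ} (i c : ℕ) (b : Bool) (s : Transcript n k) :
    transcriptCount i c b s ≤ s.length := by
  unfold transcriptCount
  induction s with
  | nil => simp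
  | cons x s ih =>
    simp only [List.map_cons, List.sum_cons, List.length_cons]
    split_ifs <;> omega

theorem Val.size_le_size_ofList {L : List Val} {v : Val} (h : v ∈ L) :
    v.size ≤ (Val.ofList L).size := by
  induction L with
  | nil => simp at h
  | cons w L ih =>
    simp only [Val.ofList, Val.size]
    rcases List.mem_cons.1 h with rfl | h
    · omega
    · have := ih h
      omega

theorem runningMin_le (T : ℕ) (rel U : ℕ → ℕ) (m : ℕ) : runningMin T rel U m ≤ T := by
  induction m with
  | zero => exact le_rfl
  | succ m ih =>
    unfold runningMin
    split_ifs
    · exact ih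
    · exact (min_le_left _ _).trans ih

theorem length_le_size_encTranscript {n k : ℕ} (s : Transcript n k) :
    s.length ≤ (encTranscript s).size := by
  simpa [encTranscript] using Val.length_le_size_ofList (s.map encStep)

theorem stepCount_le_size {n k : ℕ} (i c : ℕ) (b : Bool) (h : List (Transcript n k)) :
    stepCount i c b h ≤ (encHistory h).size := by
  unfold stepCount encHistory
  induction h with
  | nil => simp
  | cons s h ih =>
    have h1 := transcriptCount_le_length i c b s
    have h2 := length_le_size_encTranscript s
    simp only [List.map_cons, List.sum_cons, Val.ofList, Val.size]
    omega

/-! ### Programs for counts, confidence bounds and learned weights -/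

namespace Computes

variable {ι : Type*} {μ : ι → ℕ} {e : ι → Val}

theorem transcriptCount {n k i c : ι → ℕ} {s : ∀ q, Transcript (n q) (k q)} (b : Bool)
    (hs : Computes μ e fun q => encTranscript (s q)) (hi : Computes μ e fun q => .num (i q))
    (hc : Computes μ e fun q => .num (c q)) :
    Computes μ e fun q => .num (transcriptCount (i q) (c q) b (s q)) := by
  refine listSum (enc := fun q => encStep) hs ?_ ((PolyBdd.const 1).mono fun q => ?_)
  · obtain ⟨B, hB⟩ := hs.size_right
    have hz : PolyBdd (fun q : (q : ι) × {x // x ∈ s q} => μ q.1)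
        fun q => (encStep q.2.1).size :=
      ⟨B, fun q => (Val.size_le_size_ofList
        (List.mem_map.2 ⟨_, q.2.2, rfl⟩)).trans (hB q.1)⟩
    have he := (hs.size_left.reindex fun q : (q : ι) × {x // x ∈ s q} => q.1).size_pair hz
    have hx := snd (refl he)
    have h1 := fst hx
    have h2 := fst (snd hx)
    have h3 := snd (snd hx)
    have hi' := hi.lift hz
    have hc' := hc.lift hz
    have hb := const he (.num (if b then 1 else 0))
    -- The indicator of three equalities is 1 minus the sum of the three distances, each distance
    -- being the sum of the two truncated differences.
    refine ((const he (.num 1)).sub ((((h1.sub hi').add (hi'.sub h1)).add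
      ((h2.sub hc').add (hc'.sub h2))).add ((h3.sub hb).add (hb.sub h3)))).congr fun q => ?_
    congr 1
    rcases q with ⟨q, ⟨x, y, z⟩, hx⟩
    simp only
    cases z <;> cases b <;> simp only [if_true, if_false, Bool.false_eq_true, and_true, and_false,
      reduceCtorEq] <;> grind
  · split_ifs <;> omega

theorem stepCount {n k i c : ι → ℕ} {h : ∀ q, List (Transcript (n q) (k q))} (b : Bool)
    (hh : Computes μ e fun q => encHistory (h q)) (hi : Computes μ e fun q => .num (i q))
    (hc : Computes μ e fun q => .num (c q)) :
    Computes μ e fun q => .num (stepCount (i q) (c q) b (h q)) := by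
  obtain ⟨B, hB⟩ := hh.size_right
  have hz : PolyBdd (fun q : (q : ι) × {x // x ∈ h q} => μ q.1)
      fun q => (encTranscript q.2.1).size :=
    ⟨B, fun q => (Val.size_le_size_ofList
      (List.mem_map.2 ⟨_, q.2.2, rfl⟩)).trans (hB q.1)⟩
  have he := (hh.size_left.reindex fun q : (q : ι) × {x // x ∈ h q} => q.1).size_pair hz
  refine listSum (enc := fun q => encTranscript) hh
    (transcriptCount b (snd (refl he)) (hi.lift hz) (hc.lift hz)) (hz.mono fun q => ?_)
  exact (transcriptCount_le_length _ _ _ _).trans (length_le_size_encTranscript _)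

/-- The ceiling logarithm is the number of doublings of 1 needed to reach M; the loop runs until M -
2^j vanishes. -/
theorem clog {M : ι → ℕ} (hb : PolyBdd μ M) (hM : Computes μ e fun q => .num (M q)) :
    Computes μ e fun q => .num (Nat.clog 2 (M q)) := by
  have hl : PolyBdd μ fun q => Nat.clog 2 (M q) :=
    hb.mono fun q => (Nat.clog_le_iff_le_pow one_lt_two).2 Nat.lt_two_pow_self.le
  have hj : PolyBdd (fun q : Below fun q => Nat.clog 2 (M q) + 1 => μ q.1.1) fun q => q.1.2 :=
    (hl.reindex _).mono fun q => Nat.le_of_lt_succ q.2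
  have hz : PolyBdd (fun q : Below fun q => Nat.clog 2 (M q) + 1 => μ q.1.1)
      fun q => (Val.pair (.num (2 ^ q.1.2)) (.num q.1.2)).size := by
    refine PolyBdd.size_pair ((hj.add (.const 2)).mono fun q => ?_) hj.size_num
    simp [Val.size, Nat.size_pow]
  have hS := (hM.size_left.reindex fun q : Below fun q => Nat.clog 2 (M q) + 1 => q.1.1).size_pair hz
  have hS' := hS.reindex fun q : Below fun q => Nat.clog 2 (M q) =>
    (⟨q.1, Nat.lt_succ_of_lt q.2⟩ : Below fun q => Nat.clog 2 (M q) + 1)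
  have hrec := loop (μ := μ) (l := fun q => Nat.clog 2 (M q))
    (s := fun q j => .pair (e q) (.pair (.num (2 ^ j)) (.num j)))
    (c := fun q j => .num (M q - 2 ^ j)) hl
    ((hM.lift hz).sub (fst (snd (refl hS))))
    (fun q j hj => by
      rw [Val.num.injEq, Nat.clog_le_iff_le_pow one_lt_two]; omega)
    ((fst (refl hS')).pair (((fst (snd (refl hS'))).mul (const hS' (.num 2))).pair
      ((snd (snd (refl hS'))).add (const hS' (.num 1)))))
  exact snd (snd (((refl hM.size_left).pair
    ((const hM.size_left (.num 1)).pair (const hM.size_left (.num 0)))).trans hrec))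

/-- Linear search for the first j with (j + 1)² > X. It is fast enough because the value of X, not
only its bit length, is polynomially bounded. -/
theorem sqrt {X : ι → ℕ} (hb : PolyBdd μ X) (hX : Computes μ e fun q => .num (X q)) :
    Computes μ e fun q => .num (Nat.sqrt (X q)) := by
  have hl : PolyBdd μ fun q => Nat.sqrt (X q) := hb.mono fun q => Nat.sqrt_le_self _
  have hz : PolyBdd (fun q : Below fun q => Nat.sqrt (X q) + 1 => μ q.1.1)
      fun q => (Val.num q.1.2).size :=
    ((hl.reindex _).mono fun q => Nat.le_of_lt_succ q.2).size_num
  have hS := (hX.size_left.reindex fun q : Below fun q => Nat.sqrt (X q) + 1 => q.1.1).size_pair hz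
  have hS' := hS.reindex fun q : Below fun q => Nat.sqrt (X q) =>
    (⟨q.1, Nat.lt_succ_of_lt q.2⟩ : Below fun q => Nat.sqrt (X q) + 1)
  have hj := (snd (refl hS)).add (const hS (.num 1))
  have hrec := loop (μ := μ) (l := fun q => Nat.sqrt (X q))
    (s := fun q j => .pair (e q) (.num j))
    (c := fun q j => .num (X q + 1 - (j + 1) * (j + 1))) hl
    (((hX.lift hz).add (const hS (.num 1))).sub (hj.mul hj))
    (fun q j hj => by
      rw [Val.num.injEq, ← Nat.lt_succ_iff, Nat.sqrt_lt, Nat.succ_eq_add_one]; omega)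
    ((fst (refl hS')).pair ((snd (refl hS')).add (const hS' (.num 1))))
  exact snd (((refl hX.size_left).pair (const hX.size_left (.num 0))).trans hrec)

theorem upperEst {T L N H : ι → ℕ} (hLb : PolyBdd μ L) (hNb : PolyBdd μ N)
    (hT : Computes μ e fun q => .num (T q)) (hL : Computes μ e fun q => .num (L q))
    (hN : Computes μ e fun q => .num (N q)) (hH : Computes μ e fun q => .num (H q)) :
    Computes μ e fun q => .num (upperEst (T q) (L q) (N q) (H q)) := by
  have he := hT.size_left
  have hr : Computes μ e fun q => .num (radius (L q) (N q)) :=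
    (sqrt (((PolyBdd.const 8).mul hLb).mul hNb) (((const he (.num 8)).mul hL).mul hN)).add
      (const he (.num 1))
  exact hN.ite_num hT (((hT.mul (hH.add hr)).div hN).add (const he (.num 1)))

theorem runningMin {T m : ι → ℕ} {rel U : ι → ℕ → ℕ} (hTb : PolyBdd μ T) (hmb : PolyBdd μ m)
    (hT : Computes μ e fun q => .num (T q)) (hm : Computes μ e fun q => .num (m q))
    (hrel : Computes (fun q : Below m => μ q.1.1) (fun q => .pair (e q.1.1) (.num q.1.2))
      fun q => .num (rel q.1.1 q.1.2))
    (hU : Computes (fun q : Below m => μ q.1.1) (fun q => .pair (e q.1.1) (.num q.1.2))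
      fun q => .num (U q.1.1 q.1.2)) :
    Computes μ e fun q => .num (runningMin (T q) (rel q) (U q) (m q)) := by
  refine natRec (s := fun q j => .num (BinaryFeedback.runningMin (T q) (rel q) (U q) j)) hmb hm hT ?_
  have hz : PolyBdd (fun q : Below m => μ q.1.1) fun q => (Val.pair (.num q.1.2)
      (.num (BinaryFeedback.runningMin (T q.1.1) (rel q.1.1) (U q.1.1) q.1.2))).size :=
    ((hmb.reindex _).mono fun q => q.2.le).size_num.size_pair
      ((hTb.reindex _).mono fun q => runningMin_le _ _ _ _).size_num
  have he := (hT.size_left.reindex fun q : Below m => q.1.1).size_pair hz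
  have hin := (fst (refl he)).pair (fst (snd (refl he)))
  have hacc := snd (snd (refl he))
  exact (hin.trans hrel).ite_num hacc (hacc.min (hin.trans hU))

theorem relevant (dir : Bool) {c j : ι → ℕ} (hc : Computes μ e fun q => .num (c q))
    (hj : Computes μ e fun q => .num (j q)) :
    Computes μ e fun q => .num (relevant dir (c q) (j q)) := by
  have he := hc.size_left
  cases dir
  · exact hj.mul ((hj.add (const he (.num 1))).sub hc)
  · exact hj.mul ((hc.add (const he (.num 1))).sub hj)

section Estimates

variable {n k T i c : ι → ℕ} {h : ∀ q, List (Transcript (n q) (k q))}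

theorem bitEst (dir : Bool) (hnb : PolyBdd μ n) (hkb : PolyBdd μ k) (hTb : PolyBdd μ T)
    (hn : Computes μ e fun q => .num (n q)) (hk : Computes μ e fun q => .num (k q))
    (hT : Computes μ e fun q => .num (T q)) (hh : Computes μ e fun q => encHistory (h q))
    (hi : Computes μ e fun q => .num (i q)) (hc : Computes μ e fun q => .num (c q)) :
    Computes μ e fun q => .num (bitEst dir (T q) (h q) (i q) (c q)) := by
  have hMb := (hkb.mul hnb).mul hTb
  refine upperEst (hMb.mono fun q =>
      (Nat.clog_le_iff_le_pow one_lt_two).2 Nat.lt_two_pow_self.le)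
    ((hh.size_right.add hh.size_right).mono fun q =>
      Nat.add_le_add (stepCount_le_size _ _ _ _) (stepCount_le_size _ _ _ _))
    hT (clog hMb ((hk.mul hn).mul hT)) ((stepCount true hh hi hc).add (stepCount false hh hi hc))
    (stepCount dir hh hi hc)

theorem tailEst (dir : Bool) (hnb : PolyBdd μ n) (hkb : PolyBdd μ k) (hTb : PolyBdd μ T)
    (hn : Computes μ e fun q => .num (n q)) (hk : Computes μ e fun q => .num (k q))
    (hT : Computes μ e fun q => .num (T q)) (hh : Computes μ e fun q => encHistory (h q))
    (hi : Computes μ e fun q => .num (i q)) (hc : Computes μ e fun q => .num (c q)) :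
    Computes μ e fun q => .num (tailEst dir (T q) (h q) (i q) (c q)) := by
  have he := hn.size_left
  have hj : PolyBdd (fun q : Below k => μ q.1.1) fun q => (Val.num q.1.2).size :=
    ((hkb.reindex _).mono fun q => q.2.le).size_num
  have he' := (he.reindex fun q : Below k => q.1.1).size_pair hj
  have hM : Computes μ e fun q => .num (BinaryFeedback.runningMin (T q)
      (BinaryFeedback.relevant dir (c q)) (BinaryFeedback.bitEst dir (T q) (h q) (i q)) (k q)) :=
    runningMin hTb hkb hT hk (relevant dir (hc.lift hj) (snd (refl he')))
      (bitEst dir (hnb.reindex _) (hkb.reindex _) (hTb.reindex _) (hn.lift hj) (hk.lift hj)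
        (hT.lift hj) (hh.lift hj) (hi.lift hj) (snd (refl he')))
  refine hc.ite_num hT ((hk.sub hc).ite_num (const he (.num 0)) ?_)
  cases dir
  · exact hT.sub hM
  · exact hM

theorem learnedWeights (dir : Bool) (hnb : PolyBdd μ n) (hkb : PolyBdd μ k) (hTb : PolyBdd μ T)
    (hn : Computes μ e fun q => .num (n q)) (hk : Computes μ e fun q => .num (k q))
    (hT : Computes μ e fun q => .num (T q)) (hh : Computes μ e fun q => encHistory (h q)) :
    Computes μ e fun q => encWeights (learnedWeights dir (T q) (h q)) := by
  have hi : PolyBdd (fun q : Below n => μ q.1.1) fun q => (Val.num q.1.2).size :=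
    ((hnb.reindex _).mono fun q => q.2.le).size_num
  have he := (hn.size_left.reindex fun q : Below n => q.1.1).size_pair hi
  have hk' := hk.lift hi
  have hkb' := hkb.reindex fun q : Below n => q.1.1
  have hj : PolyBdd (fun q : Below fun q : Below n => k q.1.1 => μ q.1.1.1.1)
      fun q => (Val.num q.1.2).size :=
    ((hkb'.reindex fun q : Below fun q : Below n => k q.1.1 => q.1.1).mono
      fun q => q.2.le).size_num
  have he' := (he.reindex fun q : Below fun q : Below n => k q.1.1 => q.1.1).size_pair hj
  have htail : ∀ {c : (Below fun q : Below n => k q.1.1) → ℕ},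
      Computes _ _ (fun q => .num (c q)) → _ := fun {c} hc =>
    tailEst dir (hnb.reindex fun q : Below fun q : Below n => k q.1.1 => q.1.1.1.1)
      (hkb'.reindex _) (hTb.reindex _)
      ((hn.lift hi).lift hj) (hk'.lift hj) ((hT.lift hi).lift hj)
      ((hh.lift hi).lift hj) ((snd (refl he)).lift hj) hc
  have hrow := tabulate (g := fun (q : Below n) c =>
    .num (BinaryFeedback.tailEst dir (T q.1.1) (h q.1.1) q.1.2 c -
      BinaryFeedback.tailEst dir (T q.1.1) (h q.1.1) q.1.2 (c + 1))) hkb' hk' ((htail (snd (refl he'))).sub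
    (htail ((snd (refl he')).add (const he' (.num 1)))))
  refine (tabulate (g := fun q i => .ofList ((List.range (k q)).map fun c =>
    .num (BinaryFeedback.tailEst dir (T q) (h q) i c -
      BinaryFeedback.tailEst dir (T q) (h q) i (c + 1)))) hnb hn hrow).congr fun q => ?_
  simp only [encWeights, BinaryFeedback.learnedWeights, List.ofFn_eq_map,
    ← List.map_coe_finRange_eq_range, List.map_map]
  rfl

end Estimates

end Computes

/-! ### The learner: size of its input and simulation of the offline algorithm -/

namespace DTree

variable {n k : ℕ}

/-- The items probed on the way to a visited state are distinct. -/
theorem NoRepeat.nodup_of_mem_trace {σ : DTree n k} {used : Set (Fin n)} (hσ : σ.NoRepeat used)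
    {x : Realization n k} {s : Transcript n k × Option (Fin n × Fin k)} (hs : s ∈ σ.trace x) :
    (s.1.map Prod.fst).Nodup ∧ ∀ i ∈ s.1.map Prod.fst, i ∉ used := by
  induction σ generalizing used s with
  | leaf =>
    simp only [trace, List.mem_singleton] at hs
    subst hs
    simp
  | probe i c yes no ihy ihn =>
    obtain ⟨hi, hy, hn⟩ := hσ
    simp only [trace, List.mem_cons] at hs
    rcases hs with rfl | hs
    · simp
    · split_ifs at hs <;> obtain ⟨s, hm, rfl⟩ := List.mem_map.1 hs
      · have := ihy hy hm
        refine ⟨List.nodup_cons.2 ⟨fun h => this.2 i h (Set.mem_insert _ _), this.1⟩,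
          fun j hj => ?_⟩
        rcases List.mem_cons.1 hj with rfl | hj
        · exact hi
        · exact fun h => this.2 j hj (Set.mem_insert_of_mem _ h)
      · have := ihn hn hm
        refine ⟨List.nodup_cons.2 ⟨fun h => this.2 i h (Set.mem_insert _ _), this.1⟩,
          fun j hj => ?_⟩
        rcases List.mem_cons.1 hj with rfl | hj
        · exact hi
        · exact fun h => this.2 j hj (Set.mem_insert_of_mem _ h)

theorem transcript_mem_trace (σ : DTree n k) (x : Realization n k) :
    (σ.transcript x, none) ∈ σ.trace x := by
  induction σ with
  | leaf => simp [trace, transcript]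
  | probe i c yes no ihy ihn =>
    simp only [trace, transcript]
    split_ifs
    · exact List.mem_cons_of_mem _ (List.mem_map.2 ⟨_, ihy, rfl⟩)
    · exact List.mem_cons_of_mem _ (List.mem_map.2 ⟨_, ihn, rfl⟩)

theorem NoRepeat.nodup_transcript {σ : DTree n k} {used : Set (Fin n)} (hσ : σ.NoRepeat used)
    (x : Realization n k) : ((σ.transcript x).map Prod.fst).Nodup :=
  (hσ.nodup_of_mem_trace (σ.transcript_mem_trace x)).1

end DTree

theorem length_le_of_nodup_items {n k : ℕ} {s : Transcript n k}
    (hs : (s.map Prod.fst).Nodup) : s.length ≤ n := by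
  simpa using hs.length_le_card

/-- A situation in which a learning algorithm takes a decision. -/
structure LearnerState (P : ThresholdProblem) where
  I : P.Inst
  T : ℕ
  h : List (Transcript (P.inst I).n (P.inst I).k)
  s : Transcript (P.inst I).n (P.inst I).k
  length_le : h.length ≤ T
  nodup : ∀ r ∈ h, (r.map Prod.fst).Nodup
  nodup_current : (s.map Prod.fst).Nodup

namespace LearnerState

variable (P : ThresholdProblem)

/-- The quantity in which the time per decision has to be polynomial. -/
def measure (q : LearnerState P) : ℕ :=
  (P.inst q.I).n + (P.inst q.I).k + q.T + (P.enc q.I).size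

/-- Distinct items leave room for at most n steps, and one encoded step has size at most n + k + 7.
Without the restriction on repeats a state could be arbitrarily long. -/
theorem polyBdd_size_encTranscript :
    ∃ b : Polynomial ℕ, ∀ {n k : ℕ} (s : Transcript n k), (s.map Prod.fst).Nodup →
      (encTranscript s).size ≤ b.eval (n + k) := by
  refine ⟨Polynomial.X * (Polynomial.X + 7 + 1) + 1, fun {n k} s hs => ?_⟩
  refine (Val.size_ofList_le _ (n + k + 7) fun v hv => ?_).trans ?_
  · obtain ⟨⟨i, c, b⟩, -, rfl⟩ := List.mem_map.1 hv
    have h1 := natSize_le_self (i : ℕ)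
    have h2 := natSize_le_self (c : ℕ)
    have h3 : Nat.size (if b then 1 else 0) ≤ 1 := by cases b <;> simp
    simp only [encStep, Val.size]
    omega
  · have := length_le_of_nodup_items hs
    simp only [List.length_map, Polynomial.eval_add, Polynomial.eval_mul, Polynomial.eval_X,
      Polynomial.eval_ofNat, Polynomial.eval_one]
    gcongr
    omega

theorem polyBdd_size_onlineInput :
    PolyBdd (measure P) fun q => (P.onlineInput q.I q.T q.h q.s).size := by
  have hbd : ∀ f : LearnerState P → ℕ, (∀ q, f q ≤ q.measure) → PolyBdd (measure P) f :=
    fun f hf => PolyBdd.self.mono hf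
  obtain ⟨b, hb⟩ := polyBdd_size_encTranscript
  have hb' : ∀ (q : LearnerState P) (s : Transcript (P.inst q.I).n (P.inst q.I).k),
      (s.map Prod.fst).Nodup → (encTranscript s).size ≤ b.eval q.measure := fun q s hs =>
    (hb s hs).trans (polynomial_eval_mono b (by simp only [measure]; omega))
  refine (hbd _ fun q => ?_).size_pair (PolyBdd.size_pair (PolyBdd.size_pair
    (hbd _ fun q => ?_).size_num (PolyBdd.size_pair (hbd _ fun q => ?_).size_num
      (hbd _ fun q => ?_).size_num)) (PolyBdd.size_pair ?_ ⟨b, fun q => hb' q _ q.nodup_current⟩))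
  · simp only [measure]; omega
  · simp only [measure]; omega
  · simp only [measure]; omega
  · simp only [measure]; omega
  · refine (((hbd (fun q => q.T) fun q => by simp only [measure]; omega).mul
      ((PolyBdd.eval b .self).add (.const 1))).add (.const 1)).mono fun q => ?_
    refine (Val.size_ofList_le _ (b.eval q.measure) fun v hv => ?_).trans ?_
    · obtain ⟨r, hr, rfl⟩ := List.mem_map.1 hv
      exact hb' q r (q.nodup r hr)
    · rw [List.length_map]
      exact Nat.add_le_add_right (Nat.mul_le_mul_right _ q.length_le) _

theorem computes_offlineInput (dir : Bool) :
    Computes (measure P) (fun q => P.onlineInput q.I q.T q.h q.s)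
      fun q => P.offlineInput q.I (learnedWeights dir q.T q.h) q.s := by
  have hin := Computes.refl (polyBdd_size_onlineInput P)
  have hbd : ∀ f : LearnerState P → ℕ, (∀ q, f q ≤ q.measure) → PolyBdd (measure P) f :=
    fun f hf => PolyBdd.self.mono hf
  have hpar := hin.snd.fst
  have hw := Computes.learnedWeights dir (hbd (fun q => (P.inst q.I).n) fun q => by
    simp only [measure]; omega) (hbd (fun q => (P.inst q.I).k) fun q => by
    simp only [measure]; omega) (hbd (fun q => q.T) fun q => by
    simp only [measure]; omega) hpar.fst hpar.snd.fst hpar.snd.snd hin.snd.snd.fst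
  exact hin.fst.pair (hw.pair hin.snd.snd.snd)

/-- A polynomial-time offline algorithm can be run on learned weights in polynomial time. -/
theorem exists_learner (dir : Bool) (alg : Prog) (b : Polynomial ℕ) :
    ∃ (learner : Prog) (c : Polynomial ℕ), ∀ (q : LearnerState P) (d : Val),
      (∃ t ≤ b.eval (P.offlineInput q.I (learnedWeights dir q.T q.h) q.s).size,
        Runs alg (P.offlineInput q.I (learnedWeights dir q.T q.h) q.s) d t) →
      ∃ t ≤ c.eval q.measure, Runs learner (P.onlineInput q.I q.T q.h q.s) d t := by
  have H := computes_offlineInput P dir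
  obtain ⟨c', hc'⟩ := H.size_right
  obtain ⟨p, τ, ⟨c, hc⟩, hr⟩ := H
  -- Preparing the offline input costs at most `c`; its size is at most `c'`, so the offline run
  -- costs at most `b` evaluated at `c'`.
  refine ⟨.comp alg p, c + b.comp c' + 1, fun q d ⟨t, ht, hd⟩ => ⟨_, ?_, .comp (hr q) hd⟩⟩
  have h1 := hc q
  have h2 := polynomial_eval_mono b (hc' q)
  simp only [Polynomial.eval_add, Polynomial.eval_comp, Polynomial.eval_one] at h2 ⊢
  omega

end LearnerState

/-! ## Expectations over realizations -/

section Expectations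

variable {n k : ℕ} {D : Fin n → Fin k → ℝ}

/-- The probability that item `i` is at least the `c`-th support value. -/
noncomputable def tail (D : Fin n → Fin k → ℝ) (i : Fin n) (c : Fin k) : ℝ :=
  ∑ j, if c ≤ j then D i j else 0

theorem IsDist.nonneg (hD : IsDist D) (i : Fin n) (j : Fin k) : 0 ≤ D i j := (hD i).1 j

theorem IsDist.sum_eq (hD : IsDist D) (i : Fin n) : ∑ j, D i j = 1 := (hD i).2

theorem tail_nonneg (hD : IsDist D) (i : Fin n) (c : Fin k) : 0 ≤ tail D i c :=
  Finset.sum_nonneg fun j _ => by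
    split_ifs
    exacts [hD.nonneg i j, le_rfl]

theorem tail_le_one (hD : IsDist D) (i : Fin n) (c : Fin k) : tail D i c ≤ 1 := by
  rw [← hD.sum_eq i]
  refine Finset.sum_le_sum fun j _ => ?_
  split_ifs
  exacts [le_rfl, hD.nonneg i j]

theorem prob_nonneg (hD : IsDist D) (x : Realization n k) : 0 ≤ prob D x :=
  Finset.prod_nonneg fun i _ => hD.nonneg i _

theorem sum_prob (hD : IsDist D) : ∑ x : Realization n k, prob D x = 1 := by
  have := Finset.prod_univ_sum (fun _ : Fin n => (Finset.univ : Finset (Fin k))) D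
  rw [Fintype.piFinset_univ] at this
  unfold prob
  rw [← this]
  exact Finset.prod_eq_one fun i _ => hD.sum_eq i

/-- Detailed balance: exchanging the value of item i with a fresh draw leaves the joint weight
unchanged. -/
theorem prob_update_mul (D : Fin n → Fin k → ℝ) (x : Realization n k) (i : Fin n) (j : Fin k) :
    prob D (Function.update x i j) * D i (x i) = prob D x * D i j := by
  unfold prob
  rw [← Finset.mul_prod_erase _ _ (Finset.mem_univ i), ← Finset.mul_prod_erase _ (fun l => D l (x l))
    (Finset.mem_univ i), Function.update_self]
  have : ∏ l ∈ Finset.univ.erase i, D l (Function.update x i j l) =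
      ∏ l ∈ Finset.univ.erase i, D l (x l) :=
    Finset.prod_congr rfl fun l hl => by
      rw [Function.update_of_ne (Finset.ne_of_mem_erase hl)]
  rw [this]
  ring

/-- Redrawing the value of one item does not change expectations. -/
theorem sum_prob_resample (hD : IsDist D) (i : Fin n) (g : Realization n k → ℝ) :
    ∑ x, prob D x * g x = ∑ x, prob D x * ∑ j, D i j * g (Function.update x i j) := by
  have h1 : ∑ x, prob D x * ∑ j, D i j * g (Function.update x i j) =
      ∑ q : Realization n k × Fin k, prob D q.1 * D i q.2 * g (Function.update q.1 i q.2) := by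
    rw [Fintype.sum_prod_type]
    simp only [Finset.mul_sum, mul_assoc]
  have h2 : ∑ x, prob D x * g x = ∑ q : Realization n k × Fin k, prob D q.1 * D i q.2 * g q.1 := by
    rw [Fintype.sum_prod_type]
    refine Finset.sum_congr rfl fun x _ => ?_
    simp only [mul_right_comm _ _ (g x)]
    rw [← Finset.mul_sum, hD.sum_eq, mul_one]
  rw [h1, h2]
  -- Swapping the stored value of item i with the fresh value is an involution on pairs of a
  -- realization and a draw.
  refine Finset.sum_nbij' (fun q => (Function.update q.1 i q.2, q.1 i))
    (fun q => (Function.update q.1 i q.2, q.1 i)) (by simp) (by simp) (by simp) (by simp) ?_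
  rintro ⟨x, j⟩ -
  simp only [Function.update_idem, Function.update_eq_self]
  rw [prob_update_mul]

namespace DTree

/-- The expectation of a function of the transcript when the observed bits are independent with
the given success probabilities. -/
noncomputable def expect (p : Fin n → Fin k → ℝ) : DTree n k → (Transcript n k → ℝ) → ℝ
  | leaf, F => F []
  | probe i c yes no, F =>
      p i c * yes.expect p (fun s => F ((i, c, true) :: s)) +
        (1 - p i c) * no.expect p (fun s => F ((i, c, false) :: s))

theorem NoRepeat.transcript_update {σ : DTree n k} {used : Set (Fin n)} (hσ : σ.NoRepeat used)
    {i : Fin n} (hi : i ∈ used) (x : Realization n k) (j : Fin k) :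
    σ.transcript (Function.update x i j) = σ.transcript x := by
  induction σ generalizing used with
  | leaf => rfl
  | probe l c yes no ihy ihn =>
    obtain ⟨hl, hy, hn⟩ := hσ
    have hne : l ≠ i := fun h => hl (h ▸ hi)
    simp only [transcript, Function.update_of_ne hne, ihy hy (Set.mem_insert_of_mem _ hi),
      ihn hn (Set.mem_insert_of_mem _ hi)]

/-- The probed item does not occur below its node, so redrawing its value changes only the bit at
that node, and this bit is independent of what follows. The law of the transcript thus depends on
the distributions only through the tails. -/
theorem NoRepeat.sum_prob_transcript (hD : IsDist D) {σ : DTree n k} {used : Set (Fin n)}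
    (hσ : σ.NoRepeat used) (F : Transcript n k → ℝ) :
    ∑ x, prob D x * F (σ.transcript x) = σ.expect (tail D) F := by
  induction σ generalizing used F with
  | leaf =>
    simp only [transcript, expect]
    rw [← Finset.sum_mul, sum_prob hD, one_mul]
  | probe i c yes no ihy ihn =>
    obtain ⟨hi, hy, hn⟩ := hσ
    have hi' := Set.mem_insert i used
    rw [expect, ← ihy hy, ← ihn hn, sum_prob_resample hD i]
    rw [Finset.mul_sum, Finset.mul_sum, ← Finset.sum_add_distrib]
    refine Finset.sum_congr rfl fun x _ => ?_
    have h1 : ∀ j, D i j * F ((probe i c yes no).transcript (Function.update x i j)) =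
        (if c ≤ j then D i j else 0) * F ((i, c, true) :: yes.transcript x) +
          (D i j - if c ≤ j then D i j else 0) * F ((i, c, false) :: no.transcript x) := fun j => by
      simp only [transcript, Function.update_self, hy.transcript_update hi',
        hn.transcript_update hi']
      split_ifs <;> ring
    simp only [h1]
    rw [Finset.sum_add_distrib, ← Finset.sum_mul, ← Finset.sum_mul, Finset.sum_sub_distrib,
      hD.sum_eq]
    simp only [tail]
    ring

variable {p q : Fin n → Fin k → ℝ}

theorem expect_add (σ : DTree n k) (F G : Transcript n k → ℝ) :
    σ.expect p (fun s => F s + G s) = σ.expect p F + σ.expect p G := by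
  induction σ generalizing F G with
  | leaf => rfl
  | probe i c yes no ihy ihn => simp only [expect, ihy, ihn]; ring

theorem expect_const_mul (σ : DTree n k) (a : ℝ) (F : Transcript n k → ℝ) :
    σ.expect p (fun s => a * F s) = a * σ.expect p F := by
  induction σ generalizing F with
  | leaf => rfl
  | probe i c yes no ihy ihn => simp only [expect, ihy, ihn]; ring

theorem expect_const (σ : DTree n k) (a : ℝ) : σ.expect p (fun _ => a) = a := by
  induction σ with
  | leaf => rfl
  | probe i c yes no ihy ihn => simp only [expect, ihy, ihn]; ring

theorem expect_mono (hp0 : ∀ i c, 0 ≤ p i c) (hp1 : ∀ i c, p i c ≤ 1) (σ : DTree n k)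
    {F G : Transcript n k → ℝ} (h : ∀ s, F s ≤ G s) : σ.expect p F ≤ σ.expect p G := by
  induction σ generalizing F G with
  | leaf => exact h _
  | probe i c yes no ihy ihn =>
    exact add_le_add (mul_le_mul_of_nonneg_left (ihy fun s => h _) (hp0 i c))
      (mul_le_mul_of_nonneg_left (ihn fun s => h _) (sub_nonneg.2 (hp1 i c)))

/-- Changing the success probabilities changes the expectation of a function with values in
`[0, B]` by at most `B` times the expected total change on the path that is followed. -/
theorem abs_expect_sub_le (hp0 : ∀ i c, 0 ≤ p i c) (hp1 : ∀ i c, p i c ≤ 1)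
    (hq0 : ∀ i c, 0 ≤ q i c) (hq1 : ∀ i c, q i c ≤ 1) {B : ℝ} (σ : DTree n k)
    {F : Transcript n k → ℝ} (hF0 : ∀ s, 0 ≤ F s) (hFB : ∀ s, F s ≤ B) :
    |σ.expect p F - σ.expect q F| ≤
      B * σ.expect p fun s => (s.map fun r => |p r.1 r.2.1 - q r.1 r.2.1|).sum := by
  induction σ generalizing F with
  | leaf => simp [expect]
  | probe i c yes no ihy ihn =>
    have hy := ihy (F := fun s => F ((i, c, true) :: s)) (fun s => hF0 _) (fun s => hFB _)
    have hn := ihn (F := fun s => F ((i, c, false) :: s)) (fun s => hF0 _) (fun s => hFB _)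
    have by0 : 0 ≤ yes.expect q fun s => F ((i, c, true) :: s) := by
      rw [← yes.expect_const (p := q) 0]; exact yes.expect_mono hq0 hq1 fun s => hF0 _
    have bn0 : 0 ≤ no.expect q fun s => F ((i, c, false) :: s) := by
      rw [← no.expect_const (p := q) 0]; exact no.expect_mono hq0 hq1 fun s => hF0 _
    have by1 : (yes.expect q fun s => F ((i, c, true) :: s)) ≤ B := by
      conv_rhs => rw [← yes.expect_const (p := q) B]
      exact yes.expect_mono hq0 hq1 fun s => hFB _
    have bn1 : (no.expect q fun s => F ((i, c, false) :: s)) ≤ B := by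
      conv_rhs => rw [← no.expect_const (p := q) B]
      exact no.expect_mono hq0 hq1 fun s => hFB _
    simp only [expect, List.map_cons, List.sum_cons, expect_add, expect_const]
    set a := yes.expect p fun s => F ((i, c, true) :: s)
    set a' := yes.expect q fun s => F ((i, c, true) :: s)
    set b := no.expect p fun s => F ((i, c, false) :: s)
    set b' := no.expect q fun s => F ((i, c, false) :: s)
    set A := yes.expect p fun s => (s.map fun r => |p r.1 r.2.1 - q r.1 r.2.1|).sum
    set A' := no.expect p fun s => (s.map fun r => |p r.1 r.2.1 - q r.1 r.2.1|).sum
    -- The first two terms compare the subtrees and are handled by induction; the third charges the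
    -- change of the bit at this node. As a' and b' both lie in [0, B], its factor is B rather than
    -- 2B.
    have e : p i c * a + (1 - p i c) * b - (q i c * a' + (1 - q i c) * b') =
        p i c * (a - a') + (1 - p i c) * (b - b') + (p i c - q i c) * (a' - b') := by ring
    have hab : |a' - b'| ≤ B := abs_le.2 ⟨by linarith, by linarith⟩
    have hP := hp0 i c
    have hP1 : 0 ≤ 1 - p i c := sub_nonneg.2 (hp1 i c)
    rw [e]
    calc |p i c * (a - a') + (1 - p i c) * (b - b') + (p i c - q i c) * (a' - b')|
        ≤ |p i c * (a - a')| + |(1 - p i c) * (b - b')| + |(p i c - q i c) * (a' - b')| :=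
          abs_add_three _ _ _
      _ = p i c * |a - a'| + (1 - p i c) * |b - b'| + |p i c - q i c| * |a' - b'| := by
          rw [abs_mul, abs_mul, abs_mul, abs_of_nonneg hP, abs_of_nonneg hP1]
      _ ≤ p i c * (B * A) + (1 - p i c) * (B * A') + |p i c - q i c| * B := by
          gcongr
      _ = _ := by ring

/-- A product of weights of the steps with conditional means at most `1` has mean at most `1`. -/
theorem expect_prod_le_one (hp0 : ∀ i c, 0 ≤ p i c) (hp1 : ∀ i c, p i c ≤ 1) (σ : DTree n k)
    {w : Fin n × Fin k × Bool → ℝ} (hw0 : ∀ r, 0 ≤ w r)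
    (hw : ∀ i c, p i c * w (i, c, true) + (1 - p i c) * w (i, c, false) ≤ 1) :
    σ.expect p (fun s => (s.map w).prod) ≤ 1 := by
  induction σ with
  | leaf => simp [expect]
  | probe i c yes no ihy ihn =>
    simp only [expect, List.map_cons, List.prod_cons, expect_const_mul]
    refine le_trans (add_le_add
      (mul_le_mul_of_nonneg_left (mul_le_of_le_one_right (hw0 _) ihy) (hp0 i c))
      (mul_le_mul_of_nonneg_left (mul_le_of_le_one_right (hw0 _) ihn) (sub_nonneg.2 (hp1 i c))))
      (hw i c)

end DTree

end Expectations

/-! ## Expectations over histories -/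

section Histories

variable {n k : ℕ} {D : Fin n → Fin k → ℝ} {rule : List (Transcript n k) → DTree n k}

/-- The expectation of a function of the history of the first `m` periods when `rule` is
followed. -/
noncomputable def histExpect (D : Fin n → Fin k → ℝ) (rule : List (Transcript n k) → DTree n k) :
    ℕ → (List (Transcript n k) → ℝ) → ℝ
  | 0, G => G []
  | m + 1, G =>
      histExpect D rule m fun h => ∑ x, prob D x * G ((rule h).transcript x :: h)

/-- Histories of `m` periods in which no item is probed twice in a period. -/
def IsHistory (m : ℕ) (h : List (Transcript n k)) : Prop :=
  h.length = m ∧ ∀ s ∈ h, (s.map Prod.fst).Nodup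

theorem IsHistory.cons {m : ℕ} {h : List (Transcript n k)} (hh : IsHistory m h) {σ : DTree n k}
    (hσ : σ.NoRepeat ∅) (x : Realization n k) : IsHistory (m + 1) (σ.transcript x :: h) :=
  ⟨by simp [hh.1], fun s hs => (List.mem_cons.1 hs).elim (fun e => e ▸ hσ.nodup_transcript x)
    (hh.2 s)⟩

theorem histExpect_mono (hD : IsDist D) (hrule : ∀ h, (rule h).NoRepeat ∅) (m : ℕ)
    {F G : List (Transcript n k) → ℝ} (h : ∀ h, IsHistory m h → F h ≤ G h) :
    histExpect D rule m F ≤ histExpect D rule m G := by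
  induction m generalizing F G with
  | zero => exact h _ ⟨rfl, by simp⟩
  | succ m ih =>
    exact ih fun h' hh' => Finset.sum_le_sum fun x _ =>
      mul_le_mul_of_nonneg_left (h _ (hh'.cons (hrule h') x)) (prob_nonneg hD x)

theorem histExpect_add (m : ℕ) (F G : List (Transcript n k) → ℝ) :
    histExpect D rule m (fun h => F h + G h) = histExpect D rule m F + histExpect D rule m G := by
  induction m generalizing F G with
  | zero => rfl
  | succ m ih => simp only [histExpect, mul_add, Finset.sum_add_distrib, ih]

theorem histExpect_const_mul (m : ℕ) (a : ℝ) (F : List (Transcript n k) → ℝ) :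
    histExpect D rule m (fun h => a * F h) = a * histExpect D rule m F := by
  induction m generalizing F with
  | zero => rfl
  | succ m ih => simp only [histExpect, mul_left_comm _ a, ← Finset.mul_sum, ih]

theorem histExpect_const (hD : IsDist D) (m : ℕ) (a : ℝ) :
    histExpect D rule m (fun _ => a) = a := by
  induction m with
  | zero => rfl
  | succ m ih => simp only [histExpect, ← Finset.sum_mul, sum_prob hD, one_mul, ih]

theorem histExpect_sum {ι : Type*} (m : ℕ) (s : Finset ι) (F : ι → List (Transcript n k) → ℝ) :
    histExpect D rule m (fun h => ∑ a ∈ s, F a h) = ∑ a ∈ s, histExpect D rule m (F a) := by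
  classical
  induction s using Finset.induction_on with
  | empty =>
    have := histExpect_const_mul (D := D) (rule := rule) m 0 fun _ => 0
    simpa using this
  | insert a s ha ih => simp only [Finset.sum_insert ha, histExpect_add, ih]

/-- A product over all steps of weights with conditional means at most `1` has mean at most
`1`. -/
theorem histExpect_prod_le_one (hD : IsDist D) (hrule : ∀ h, (rule h).NoRepeat ∅) (m : ℕ)
    {w : Fin n × Fin k × Bool → ℝ} (hw0 : ∀ r, 0 ≤ w r)
    (hw : ∀ i c, tail D i c * w (i, c, true) + (1 - tail D i c) * w (i, c, false) ≤ 1) :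
    histExpect D rule m (fun h => (h.map fun s => (s.map w).prod).prod) ≤ 1 := by
  induction m with
  | zero => simp [histExpect]
  | succ m ih =>
    refine le_trans (histExpect_mono hD hrule m fun h _ => ?_) ih
    simp only [List.map_cons, List.prod_cons]
    rw [(hrule h).sum_prob_transcript hD fun s =>
      (s.map w).prod * (h.map fun s => (s.map w).prod).prod]
    simp only [mul_comm _ (h.map fun s => (s.map w).prod).prod, DTree.expect_const_mul]
    refine mul_le_of_le_one_right (List.prod_nonneg fun a ha => ?_)
      ((rule h).expect_prod_le_one (tail_nonneg hD) (tail_le_one hD) hw0 hw)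
    obtain ⟨s, -, rfl⟩ := List.mem_map.1 ha
    exact List.prod_nonneg fun a ha => by
      obtain ⟨r, -, rfl⟩ := List.mem_map.1 ha
      exact hw0 r

/-- The expectation of a function of a list of independent realizations. -/
noncomputable def listExpect (D : Fin n → Fin k → ℝ) : ℕ → (List (Realization n k) → ℝ) → ℝ
  | 0, G => G []
  | m + 1, G => ∑ x, prob D x * listExpect D m fun l => G (x :: l)

theorem sum_ofFn_eq_listExpect (m : ℕ) (G : List (Realization n k) → ℝ) :
    ∑ xs : Fin m → Realization n k, (∏ t, prob D (xs t)) * G (List.ofFn xs) =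
      listExpect D m G := by
  induction m generalizing G with
  | zero => simp [listExpect]
  | succ m ih =>
    rw [← (Fin.consEquiv fun _ : Fin (m + 1) => Realization n k).sum_comp, Fintype.sum_prod_type,
      listExpect]
    refine Finset.sum_congr rfl fun x _ => ?_
    rw [← ih, Finset.mul_sum]
    refine Finset.sum_congr rfl fun xs _ => ?_
    simp [Fin.consEquiv, Fin.prod_univ_succ, List.ofFn_succ, mul_assoc]

theorem listExpect_const (hD : IsDist D) (m : ℕ) (a : ℝ) : listExpect D m (fun _ => a) = a := by
  induction m with
  | zero => rfl
  | succ m ih => rw [listExpect, ← Finset.sum_mul, sum_prob hD, one_mul, ih]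

/-- `listExpect` splits off the first realization, whereas histories grow with the last one;
independence lets the last be split off instead. -/
theorem listExpect_concat (m : ℕ) (G : List (Realization n k) → ℝ) :
    listExpect D (m + 1) G = listExpect D m fun l => ∑ x, prob D x * G (l ++ [x]) := by
  induction m generalizing G with
  | zero => rfl
  | succ m ih =>
    rw [listExpect, listExpect]
    exact Finset.sum_congr rfl fun x _ => congrArg _ (ih _)

/-- Realizations after period t integrate to 1, so only the first t and the current one matter. The
default 0 is never used, since t < m. -/
theorem listExpect_take (hD : IsDist D) {m t : ℕ} (ht : t < m)
    (Q : List (Realization n k) → Realization n k → ℝ) :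
    (listExpect D m fun l => (l[t]?).elim 0 (Q (l.take t))) =
      listExpect D t fun l => ∑ x, prob D x * Q l x := by
  induction m generalizing t Q with
  | zero => omega
  | succ m ih =>
    cases t with
    | zero => simp [listExpect, listExpect_const hD]
    | succ t =>
      simp only [listExpect, List.getElem?_cons_succ, List.take_succ_cons]
      refine Finset.sum_congr rfl fun x _ => ?_
      rw [ih (by omega) fun l => Q (x :: l)]

theorem listExpect_history (I : Instance) {D : Fin I.n → Fin I.k → ℝ}
    (rule : List (Transcript I.n I.k) → DTree I.n I.k) (m : ℕ)
    (K : List (Transcript I.n I.k) → ℝ) :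
    (listExpect D m fun l => K (I.history rule l.reverse)) = histExpect D rule m K := by
  induction m generalizing K with
  | zero => rfl
  | succ m ih =>
    rw [listExpect_concat, histExpect, ← ih]
    simp only [List.reverse_append, List.reverse_cons, List.reverse_nil, List.nil_append,
      List.singleton_append, Instance.history]

/-- The expected total objective is the sum over the periods of the expected value of the policy
that is used. -/
theorem Instance.expTotal_eq_sum (I : Instance) {D : Fin I.n → Fin I.k → ℝ} (hD : IsDist D)
    (rule : List (Transcript I.n I.k) → DTree I.n I.k) (T : ℕ) :
    I.expTotal rule T D =
      ∑ t ∈ Finset.range T, histExpect D rule t fun h => I.expValue D (rule h) := by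
  unfold Instance.expTotal
  simp only [Finset.mul_sum]
  rw [Finset.sum_comm, ← Fin.sum_univ_eq_sum_range
    (fun t => histExpect D rule t fun h => I.expValue D (rule h))]
  refine Finset.sum_congr rfl fun t _ => ?_
  rw [← listExpect_history]
  unfold Instance.expValue
  rw [← listExpect_take hD t.2 fun l x => I.value (rule (I.history rule l.reverse)) x,
    ← sum_ofFn_eq_listExpect]
  refine Finset.sum_congr rfl fun xs _ => ?_
  simp [Instance.historyBefore]

end Histories

/-! ## Counting observations -/

section Counting

variable {n k : ℕ}

theorem stepCount_cons (i c : ℕ) (b : Bool) (s : Transcript n k) (h : List (Transcript n k)) :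
    stepCount i c b (s :: h) = transcriptCount i c b s + stepCount i c b h := by
  simp [stepCount]

theorem transcriptCount_cons (i c : ℕ) (b : Bool) (r : Fin n × Fin k × Bool)
    (s : Transcript n k) :
    transcriptCount i c b (r :: s) =
      (if (r.1 : ℕ) = i ∧ (r.2.1 : ℕ) = c ∧ r.2.2 = b then 1 else 0) + transcriptCount i c b s := by
  simp [transcriptCount]

/-- The number of times that item `i` was probed with threshold `c` in one period. -/
def probeCountIn (i c : ℕ) (s : Transcript n k) : ℕ :=
  transcriptCount i c true s + transcriptCount i c false s

theorem probeCountIn_cons (i : Fin n) (c : Fin k) (r : Fin n × Fin k × Bool)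
    (s : Transcript n k) :
    probeCountIn i c (r :: s) = (if r.1 = i ∧ r.2.1 = c then 1 else 0) + probeCountIn i c s := by
  obtain ⟨j, d, b⟩ := r
  simp only [probeCountIn, transcriptCount_cons, Fin.val_inj]
  cases b <;> simp only [and_true, and_false, if_false, reduceCtorEq] <;> omega

theorem probeCount_cons (i c : ℕ) (s : Transcript n k) (h : List (Transcript n k)) :
    probeCount i c (s :: h) = probeCountIn i c s + probeCount i c h := by
  simp only [probeCount, probeCountIn, stepCount_cons]; omega

theorem probeCountIn_le_one {s : Transcript n k} (hs : (s.map Prod.fst).Nodup) (i : Fin n)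
    (c : Fin k) : probeCountIn i c s ≤ 1 := by
  refine le_trans ?_ (List.nodup_iff_count_le_one.1 hs i)
  clear hs
  induction s with
  | nil => simp [probeCountIn, transcriptCount]
  | cons r s ih =>
    rw [probeCountIn_cons, List.map_cons, List.count_cons]
    simp only [beq_iff_eq]
    split_ifs <;> omega

theorem probeCount_le {m : ℕ} {h : List (Transcript n k)} (hh : IsHistory m h) (i : Fin n)
    (c : Fin k) : probeCount i c h ≤ m := by
  obtain ⟨rfl, hh⟩ := hh
  induction h with
  | nil => simp [probeCount, stepCount]
  | cons s h ih =>
    have h1 := probeCountIn_le_one (hh s (by simp)) i c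
    have h2 := ih fun r hr => hh r (by simp [hr])
    rw [probeCount_cons, List.length_cons]
    omega

/-- Regroups a sum along the path by pairs of item and threshold, the form in which observations are
counted. -/
theorem sum_map_eq_sum_probeCountIn (f : Fin n → Fin k → ℝ) (s : Transcript n k) :
    (s.map fun r => f r.1 r.2.1).sum = ∑ i : Fin n, ∑ c : Fin k, (probeCountIn i c s : ℝ) * f i c := by
  induction s with
  | nil => simp [probeCountIn, transcriptCount]
  | cons r s ih =>
    obtain ⟨j, d, b⟩ := r
    simp only [List.map_cons, List.sum_cons, ih, probeCountIn_cons, Nat.cast_add, add_mul,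
      Finset.sum_add_distrib, add_left_inj]
    simp [ite_and]

theorem sum_probeCount_le {m : ℕ} {h : List (Transcript n k)} (hh : IsHistory m h) :
    ∑ i : Fin n, ∑ c : Fin k, (probeCount i c h : ℝ) ≤ n * m := by
  obtain ⟨rfl, hh⟩ := hh
  induction h with
  | nil => simp [probeCount, stepCount]
  | cons s h ih =>
    have h1 := sum_map_eq_sum_probeCountIn (fun _ _ => (1 : ℝ)) s
    have h2 := ih fun r hr => hh r (by simp [hr])
    have h3 : (s.length : ℝ) ≤ n := by exact_mod_cast length_le_of_nodup_items (hh s (by simp))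
    simp only [List.map_const', List.sum_replicate, nsmul_eq_mul, mul_one] at h1
    simp only [probeCount_cons, Nat.cast_add, Finset.sum_add_distrib, List.length_cons,
      Nat.cast_one, mul_add, mul_one, ← h1]
    linarith

end Counting

/-! ## Concentration -/

section Concentration

/-- For |x| ≤ 1 the second-order estimate of exp suffices; for x > 1 use x ≤ x², and for x < -1 use
exp x ≤ 1 ≤ x + 1 + x². After averaging a centred variable the linear term disappears and only
exp(x²) remains. -/
theorem exp_le_add_exp_sq (x : ℝ) : Real.exp x ≤ x + Real.exp (x ^ 2) := by
  have hsq := Real.add_one_le_exp (x ^ 2)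
  rcases le_or_gt |x| 1 with h | h
  · have := (abs_le.1 (Real.abs_exp_sub_one_sub_id_le h)).2
    linarith
  · rcases lt_abs.1 h with h | h
    · have := Real.exp_le_exp.2 (show x ≤ x ^ 2 by nlinarith)
      linarith
    · have := Real.exp_le_one_iff.2 (show x ≤ 0 by linarith)
      nlinarith

/-- Sub-Gaussian bound for a centred bit: the terms linear in l cancel in the mean. The exponent l²
is not the sharp l²/8, which affects only the constant. -/
theorem bernoulli_mgf_le {p : ℝ} (hp0 : 0 ≤ p) (hp1 : p ≤ 1) (l : ℝ) :
    p * Real.exp (l * (1 - p) - l ^ 2) + (1 - p) * Real.exp (l * (0 - p) - l ^ 2) ≤ 1 := by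
  have hx : ∀ y : ℝ, |y| ≤ 1 → Real.exp (l * y - l ^ 2) ≤ l * y * Real.exp (-l ^ 2) + 1 := by
    intro y hy
    have h1 := exp_le_add_exp_sq (l * y)
    have h2 : (l * y) ^ 2 ≤ l ^ 2 := by
      rw [mul_pow]
      exact mul_le_of_le_one_right (sq_nonneg l) ((sq_le_one_iff_abs_le_one y).2 hy)
    have h3 := Real.exp_le_exp.2 h2
    have h4 : Real.exp (l ^ 2) * Real.exp (-l ^ 2) = 1 := by
      rw [← Real.exp_add, add_neg_cancel, Real.exp_zero]
    rw [sub_eq_add_neg, Real.exp_add]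
    nlinarith [Real.exp_pos (-l ^ 2)]
  have h1 := hx (1 - p) (abs_le.2 ⟨by linarith, by linarith⟩)
  have h2 := hx (0 - p) (abs_le.2 ⟨by linarith, by linarith⟩)
  calc _ ≤ p * (l * (1 - p) * Real.exp (-l ^ 2) + 1) +
        (1 - p) * (l * (0 - p) * Real.exp (-l ^ 2) + 1) := by
        gcongr
    _ = 1 := by ring

variable {n k : ℕ} {D : Fin n → Fin k → ℝ} {rule : List (Transcript n k) → DTree n k}

/-- Difference between the number of observed successes of a probe and its conditional
expectation. -/
noncomputable def deviation (D : Fin n → Fin k → ℝ) (h : List (Transcript n k)) (i : Fin n)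
    (c : Fin k) : ℝ :=
  stepCount i c true h - tail D i c * probeCount i c h

/-- The factors of the exponential supermartingale of a probe. -/
noncomputable def expWeight (D : Fin n → Fin k → ℝ) (i : Fin n) (c : Fin k) (l : ℝ)
    (r : Fin n × Fin k × Bool) : ℝ :=
  if r.1 = i ∧ r.2.1 = c then Real.exp (l * ((if r.2.2 then 1 else 0) - tail D i c) - l ^ 2) else 1

/-- Only probes of the pair (i, c) contribute, so the exponents add up to the deviation and the
count. This identifies the supermartingale as a product of step weights. -/
theorem prod_expWeight (i : Fin n) (c : Fin k) (l : ℝ) (h : List (Transcript n k)) :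
    (h.map fun s => (s.map (expWeight D i c l)).prod).prod =
      Real.exp (l * deviation D h i c - l ^ 2 * probeCount i c h) := by
  have key : ∀ s : Transcript n k, (s.map (expWeight D i c l)).prod =
      Real.exp (l * (transcriptCount i c true s - tail D i c * probeCountIn i c s) -
        l ^ 2 * probeCountIn i c s) := by
    intro s
    induction s with
    | nil => simp [probeCountIn, transcriptCount]
    | cons r s ih =>
      rw [List.map_cons, List.prod_cons, ih, probeCountIn_cons, transcriptCount_cons]
      obtain ⟨j, d, b⟩ := r
      simp only [expWeight, Fin.val_inj]
      by_cases hjd : j = i ∧ d = c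
      · rw [if_pos hjd, if_pos hjd, ← Real.exp_add]
        obtain ⟨rfl, rfl⟩ := hjd
        cases b <;> simp <;> ring
      · rw [if_neg hjd, if_neg hjd, if_neg fun h => hjd ⟨h.1, h.2.1⟩]
        simp
  induction h with
  | nil => simp [deviation, probeCount, stepCount]
  | cons s h ih =>
    rw [List.map_cons, List.prod_cons, ih, key, ← Real.exp_add]
    simp only [deviation, probeCount_cons, stepCount_cons, Nat.cast_add]
    ring_nf

theorem histExpect_exp_deviation_le (hD : IsDist D) (hrule : ∀ h, (rule h).NoRepeat ∅) (m : ℕ)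
    (i : Fin n) (c : Fin k) (l : ℝ) :
    histExpect D rule m
      (fun h => Real.exp (l * deviation D h i c - l ^ 2 * probeCount i c h)) ≤ 1 := by
  simp only [← prod_expWeight]
  refine histExpect_prod_le_one hD hrule m (fun r => ?_) fun j d => ?_
  · unfold expWeight
    split_ifs <;> positivity
  · unfold expWeight
    by_cases hjd : j = i ∧ d = c
    · obtain ⟨rfl, rfl⟩ := hjd
      simpa using bernoulli_mgf_le (tail_nonneg hD j d) (tail_le_one hD j d) l
    · simp [hjd]

/-- All deviations are within the confidence radius. -/
def Accurate (D : Fin n → Fin k → ℝ) (L : ℕ) (h : List (Transcript n k)) : Prop :=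
  ∀ i c, |deviation D h i c| ≤ radius L (probeCount i c h)

theorem le_radius_sq (L N : ℕ) : (8 * L * N : ℝ) ≤ (radius L N : ℝ) ^ 2 := by
  have := (Nat.lt_succ_sqrt (8 * L * N)).le
  unfold radius
  rw [sq]
  exact_mod_cast this

/-- A pointwise Chernoff bound: some summand is at least 1 on a bad history. The best parameter
±R/(2N) depends on the random count N, while the supermartingale needs a fixed one; hence the sum
over all possible values s of N, and over both signs. -/
theorem indicator_not_accurate_le {L m T : ℕ} (hmT : m ≤ T) {h : List (Transcript n k)}
    (hh : IsHistory m h) (hbad : ¬ Accurate D L h) :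
    1 ≤ ∑ i : Fin n, ∑ c : Fin k, ∑ s ∈ Finset.Icc 1 T, ∑ e ∈ ({1, -1} : Finset ℝ),
      Real.exp (-(2 * L)) * Real.exp (e * (radius L s / (2 * s)) * deviation D h i c -
        (e * (radius L s / (2 * s))) ^ 2 * probeCount i c h) := by
  simp only [Accurate, not_forall, not_le] at hbad
  obtain ⟨i, c, hic⟩ := hbad
  set N := probeCount i c h with hN
  -- An unobserved pair has deviation 0 and cannot be inaccurate.
  have hN0 : N ≠ 0 := by
    intro h0
    have hS : stepCount i c true h = 0 := by
      have : stepCount (i : ℕ) (c : ℕ) true h ≤ N := Nat.le_add_right _ _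
      omega
    rw [deviation, ← hN, h0, hS] at hic
    simp only [Nat.cast_zero, mul_zero, sub_zero, abs_zero] at hic
    exact absurd hic (not_lt.2 (Nat.cast_nonneg _))
  have hNT : N ∈ Finset.Icc 1 T :=
    Finset.mem_Icc.2 ⟨Nat.one_le_iff_ne_zero.2 hN0, (probeCount_le hh i c).trans hmT⟩
  have hNpos : (0 : ℝ) < N := by exact_mod_cast Nat.pos_of_ne_zero hN0
  have hR : (0 : ℝ) ≤ radius L N := Nat.cast_nonneg _
  have hR2 := le_radius_sq L N
  obtain ⟨e, he, he2, hed⟩ : ∃ e ∈ ({1, -1} : Finset ℝ), e ^ 2 = 1 ∧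
      (radius L N : ℝ) ≤ e * deviation D h i c := by
    rcases lt_abs.1 hic with h | h
    · exact ⟨1, by simp, by norm_num, by linarith⟩
    · exact ⟨-1, by simp, by norm_num, by linarith⟩
  have hnn : ∀ (i : Fin n) (c : Fin k) (s : ℕ) (e : ℝ), 0 ≤ Real.exp (-(2 * L)) *
      Real.exp (e * (radius L s / (2 * s)) * deviation D h i c -
        (e * (radius L s / (2 * s))) ^ 2 * probeCount i c h) := fun _ _ _ _ => by positivity
  refine le_trans ?_ (Finset.single_le_sum (fun i _ => Finset.sum_nonneg fun c _ =>
    Finset.sum_nonneg fun s _ => Finset.sum_nonneg fun e _ => hnn i c s e) (Finset.mem_univ i))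
  refine le_trans ?_ (Finset.single_le_sum (fun c _ =>
    Finset.sum_nonneg fun s _ => Finset.sum_nonneg fun e _ => hnn i c s e) (Finset.mem_univ c))
  refine le_trans ?_ (Finset.single_le_sum (fun s _ => Finset.sum_nonneg fun e _ => hnn i c s e) hNT)
  refine le_trans ?_ (Finset.single_le_sum (fun e _ => hnn i c N e) he)
  rw [← Real.exp_add, Real.one_le_exp_iff, ← hN, mul_pow, he2, one_mul]
  have e1 : e * (radius L N / (2 * N)) * deviation D h i c =
      (radius L N / (2 * N)) * (e * deviation D h i c) := by ring
  have e2 : (radius L N / (2 * N)) * (radius L N : ℝ) ≤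
      (radius L N / (2 * N)) * (e * deviation D h i c) :=
    mul_le_mul_of_nonneg_left hed (by positivity)
  -- The exponent at the optimal parameter, R²/(4N). With R² ≥ 8LN it is at least 2L, which cancels
  -- the prefactor exp(-2L).
  have e3 : (radius L N / (2 * N)) * (radius L N : ℝ) - (radius L N / (2 * N) : ℝ) ^ 2 * N =
      (radius L N : ℝ) ^ 2 / (4 * N) := by
    field_simp
    ring
  have e4 : (2 * L : ℝ) ≤ (radius L N : ℝ) ^ 2 / (4 * N) := by
    rw [le_div_iff₀ (by positivity)]
    linarith
  rw [e1]
  linarith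

open Classical in
/-- Inaccurate histories are unlikely. -/
theorem histExpect_not_accurate_le (hD : IsDist D) (hrule : ∀ h, (rule h).NoRepeat ∅)
    {L m T : ℕ} (hmT : m ≤ T) :
    histExpect D rule m (fun h => if Accurate D L h then 0 else 1) ≤
      2 * (k * n * T) * Real.exp (-(2 * L)) := by
  refine le_trans (histExpect_mono hD hrule m (G := fun h => ∑ i : Fin n, ∑ c : Fin k,
      ∑ s ∈ Finset.Icc 1 T, ∑ e ∈ ({1, -1} : Finset ℝ),
      Real.exp (-(2 * L)) * Real.exp (e * (radius L s / (2 * s)) * deviation D h i c -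
        (e * (radius L s / (2 * s))) ^ 2 * probeCount i c h)) fun h hh => ?_) ?_
  · split_ifs with hacc
    · positivity
    · exact indicator_not_accurate_le hmT hh hacc
  · simp only [histExpect_sum, histExpect_const_mul]
    calc _ ≤ ∑ i : Fin n, ∑ c : Fin k, ∑ s ∈ Finset.Icc 1 T, ∑ e ∈ ({1, -1} : Finset ℝ),
          Real.exp (-(2 * L)) := by
          gcongr
          exact mul_le_of_le_one_right (Real.exp_pos _).le
            (histExpect_exp_deviation_le hD hrule m _ _ _)
      _ = _ := by
          have : ({1, -1} : Finset ℝ).card = 2 := Finset.card_pair (by norm_num)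
          simp only [Finset.sum_const, this, Finset.card_univ, Fintype.card_fin, Nat.card_Icc,
            nsmul_eq_mul]
          push_cast
          ring

end Concentration

/-! ## Accuracy of the monotone estimates -/

section Estimates

theorem runningMin_le_of_rel {T m j : ℕ} {rel U : ℕ → ℕ} (hj : j < m) (hrel : rel j ≠ 0) :
    runningMin T rel U m ≤ U j := by
  induction m with
  | zero => omega
  | succ m ih =>
    unfold runningMin
    rcases Nat.lt_succ_iff_lt_or_eq.1 hj with h | rfl
    · split_ifs
      · exact ih h
      · exact (min_le_left _ _).trans (ih h)
    · rw [if_neg hrel]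
      exact min_le_right _ _

theorem le_runningMin {T m : ℕ} {rel U : ℕ → ℕ} {x : ℝ} (hT : x ≤ T)
    (hU : ∀ j < m, rel j ≠ 0 → x ≤ U j) : x ≤ runningMin T rel U m := by
  induction m with
  | zero => exact hT
  | succ m ih =>
    have := ih fun j hj => hU j (by omega)
    unfold runningMin
    split_ifs with h
    · exact this
    · rw [Nat.cast_min]
      exact le_min this (hU m (by omega) h)

theorem runningMin_anti {T m : ℕ} {rel rel' U : ℕ → ℕ} (h : ∀ j, rel j ≠ 0 → rel' j ≠ 0) :
    runningMin T rel' U m ≤ runningMin T rel U m := by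
  induction m with
  | zero => exact le_rfl
  | succ m ih =>
    unfold runningMin
    have := h m
    split_ifs with h1 h2 h2
    · exact ih
    · exact absurd h1 (this h2)
    · exact (min_le_left _ _).trans ih
    · exact min_le_min ih le_rfl

theorem relevant_ne_zero {dir : Bool} {c j : ℕ} :
    relevant dir c j ≠ 0 ↔ 1 ≤ j ∧ if dir then j ≤ c else c ≤ j := by
  unfold relevant
  rw [mul_ne_zero_iff]
  cases dir <;> simp <;> omega

variable {n k : ℕ}

theorem tailEst_zero (dir : Bool) (T : ℕ) (h : List (Transcript n k)) (i : ℕ) :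
    tailEst dir T h i 0 = T := by
  simp [tailEst]

theorem tailEst_eq_zero (dir : Bool) (T : ℕ) (h : List (Transcript n k)) (i : ℕ) {c : ℕ}
    (hc : c ≠ 0) (hk : k ≤ c) : tailEst dir T h i c = 0 := by
  simp [tailEst, hc, Nat.sub_eq_zero_of_le hk]

/-- Raising the threshold enlarges the set of relevant indices for upper estimates and shrinks it
for lower ones, where the minimum is subtracted; both ways the tail goes down. Thus the differences
are honest non-negative weights. -/
theorem tailEst_succ_le (dir : Bool) (T : ℕ) (h : List (Transcript n k)) (i c : ℕ) :
    tailEst dir T h i (c + 1) ≤ tailEst dir T h i c := by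
  unfold tailEst
  rw [if_neg (Nat.succ_ne_zero c)]
  have h1 := runningMin_le T (relevant dir (c + 1)) (bitEst dir T h i) k
  have h2 : ∀ j, relevant true c j ≠ 0 → relevant true (c + 1) j ≠ 0 := fun j => by
    simp only [relevant_ne_zero, if_true]; omega
  have h3 : ∀ j, relevant false (c + 1) j ≠ 0 → relevant false c j ≠ 0 := fun j => by
    simp only [relevant_ne_zero, Bool.false_eq_true, if_false]; omega
  cases dir
  · simp only [Bool.false_eq_true, if_false]
    split_ifs <;> first | omega | exact Nat.sub_le_sub_left (runningMin_anti h3) T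
  · simp only [if_true]
    split_ifs <;> first | omega | exact runningMin_anti h2

theorem sum_ite_sub_succ (v : ℕ → ℝ) {c m : ℕ} (hc : c ≤ m) :
    ∑ j : Fin m, (if c ≤ (j : ℕ) then v j - v (j + 1) else 0) = v c - v m := by
  rw [Fin.sum_univ_eq_sum_range fun j => if c ≤ j then v j - v (j + 1) else 0]
  induction m with
  | zero => obtain rfl : c = 0 := by omega
            simp
  | succ m ih =>
    rw [Finset.sum_range_succ]
    rcases Nat.lt_succ_iff_lt_or_eq.1 (Nat.lt_succ_of_le hc) with h | rfl
    · rw [ih (by omega), if_pos (by omega)]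
      ring
    · rw [if_neg (by omega), Finset.sum_eq_zero fun j hj => if_neg (by
        have := Finset.mem_range.1 hj; omega)]
      ring

theorem cast_learnedWeights (dir : Bool) (T : ℕ) (h : List (Transcript n k)) (i : Fin n)
    (j : Fin k) : (learnedWeights dir T h i j : ℝ) =
      tailEst dir T h i j - tailEst dir T h i (j + 1) := by
  rw [learnedWeights, Nat.cast_sub (tailEst_succ_le _ _ _ _ _)]

theorem sum_learnedWeights_ge (dir : Bool) (T : ℕ) (h : List (Transcript n k)) (i : Fin n)
    (c : Fin k) : ∑ j, (if c ≤ j then (learnedWeights dir T h i j : ℝ) else 0) =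
      tailEst dir T h i c := by
  have := sum_ite_sub_succ (fun j => (tailEst dir T h i j : ℝ)) c.2.le
  simp only [cast_learnedWeights, Fin.le_def]
  rw [this, tailEst_eq_zero dir T h i (c := k) (by have := c.2; omega) le_rfl, Nat.cast_zero,
    sub_zero]

/-- Telescoping between the boundary values T at threshold 0 and 0 at threshold k. The total is T
for every history, so the weights are admissible for the offline algorithm even before any data. -/
theorem sum_learnedWeights (dir : Bool) (T : ℕ) (h : List (Transcript n k)) (i : Fin n)
    (hk : 0 < k) : ∑ j, learnedWeights dir T h i j = T := by
  have := sum_learnedWeights_ge dir T h i ⟨0, hk⟩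
  simp only [Fin.le_def, Nat.zero_le, if_true, tailEst_zero] at this
  exact_mod_cast this

theorem tail_learnedWeights (dir : Bool) (T : ℕ) (h : List (Transcript n k)) (i : Fin n)
    (c : Fin k) : tail (ofWeights (learnedWeights dir T h)) i c = tailEst dir T h i c / T := by
  have hk : 0 < k := by have := c.2; omega
  simp only [tail, ofWeights, sum_learnedWeights dir T h i hk]
  rw [← sum_learnedWeights_ge, Finset.sum_div]
  refine Finset.sum_congr rfl fun j _ => ?_
  split_ifs <;> simp

theorem isDist_ofWeights {w : Fin n → Fin k → ℕ} (hw : ∀ i, 0 < ∑ j, w i j) :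
    IsDist (ofWeights w) := fun i => by
  refine ⟨fun j => by unfold ofWeights; positivity, ?_⟩
  have : ((∑ j, w i j : ℕ) : ℝ) ≠ 0 := by exact_mod_cast (hw i).ne'
  simp only [ofWeights]
  rw [← Finset.sum_div, ← Nat.cast_sum, div_self this]

variable {D : Fin n → Fin k → ℝ}

theorem tail_anti (hD : IsDist D) (i : Fin n) {c d : Fin k} (h : c ≤ d) :
    tail D i d ≤ tail D i c := by
  refine Finset.sum_le_sum fun j _ => ?_
  have := hD.nonneg i j
  split_ifs with h1 h2
  exacts [le_rfl, absurd (h.trans h1) h2, this, le_rfl]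

theorem tail_eq_one (hD : IsDist D) (i : Fin n) {c : Fin k} (h : (c : ℕ) = 0) :
    tail D i c = 1 := by
  rw [← hD.sum_eq i]
  exact Finset.sum_congr rfl fun j _ => if_pos (by rw [Fin.le_def]; omega)

/-- Bound on the error of an estimate after `N` observations. -/
noncomputable def estError (T L N : ℕ) : ℝ := if N = 0 then 1 else 2 * radius L N / N + 1 / T

theorem estError_nonneg (T L N : ℕ) : 0 ≤ estError T L N := by
  unfold estError
  split_ifs <;> positivity

/-- Adding the radius makes the frequency an upper bound; the overshoot is at most two radii, one
for the deviation and one for the shift. Rounding down and adding one unit preserves the bound and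
costs 1/T. -/
theorem upperEst_mem {T L N H : ℕ} (hT : 0 < T) {x : ℝ} (hx0 : 0 ≤ x) (hx1 : x ≤ 1)
    (h : |H - x * N| ≤ radius L N) :
    T * x ≤ upperEst T L N H ∧ upperEst T L N H ≤ T * (x + estError T L N) := by
  have hT' : (0 : ℝ) < T := by exact_mod_cast hT
  unfold upperEst estError
  split_ifs with hN
  · exact ⟨by nlinarith, by nlinarith⟩
  · have hN' : (0 : ℝ) < N := by exact_mod_cast Nat.pos_of_ne_zero hN
    obtain ⟨h1, h2⟩ := abs_le.1 h
    have h3 : ((T * (H + radius L N) / N : ℕ) : ℝ) ≤ T * (H + radius L N) / N := by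
      have := @Nat.cast_div_le ℝ _ _ _ (T * (H + radius L N)) N
      push_cast at this
      exact this
    have h4 : (T * (H + radius L N) / N : ℝ) ≤ ((T * (H + radius L N) / N : ℕ) : ℝ) + 1 := by
      have := (Nat.lt_succ_iff.1 (Nat.lt_succ_of_lt (Nat.lt_mul_div_succ (T * (H + radius L N))
        (Nat.pos_of_ne_zero hN))))
      rw [div_le_iff₀ hN', mul_comm _ (N : ℝ)]
      exact_mod_cast this
    push_cast
    constructor
    · refine le_trans ?_ h4
      rw [le_div_iff₀ hN', mul_assoc]
      exact mul_le_mul_of_nonneg_left (by linarith) hT'.le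
    · have h5 : (T * (H + radius L N) / N : ℝ) ≤ T * (x + 2 * radius L N / N) := by
        rw [div_le_iff₀ hN', mul_assoc]
        refine mul_le_mul_of_nonneg_left ?_ hT'.le
        rw [add_mul, div_mul_cancel₀ _ hN'.ne']
        linarith
      have h6 : (T : ℝ) * (1 / T) = 1 := by field_simp
      rw [← add_assoc, mul_add (T : ℝ) _ (1 / (T : ℝ)), h6]
      linarith

/-- For accurate histories the estimates for a single probe are correct. -/
theorem Accurate.bitEst_mem (hD : IsDist D) {T : ℕ} (hT : 0 < T) {h : List (Transcript n k)}
    (hh : Accurate D (Nat.clog 2 (k * n * T)) h) (dir : Bool) (i : Fin n) (c : Fin k) {x : ℝ}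
    (hx : x = if dir then tail D i c else 1 - tail D i c) :
    T * x ≤ bitEst dir T h i c ∧
      bitEst dir T h i c ≤
        T * (x + estError T (Nat.clog 2 (k * n * T)) (probeCount i c h)) := by
  have h0 := tail_nonneg hD i c
  have h1 := tail_le_one hD i c
  have hN : (probeCount i c h : ℝ) = stepCount i c true h + stepCount i c false h := by
    simp [probeCount]
  have hacc := hh i c
  cases dir
  · simp only [Bool.false_eq_true, if_false] at hx
    subst hx
    refine upperEst_mem hT (by linarith) (by linarith) (le_trans (le_of_eq ?_) hacc)
    rw [deviation, ← abs_neg]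
    congr 1
    rw [hN]
    ring
  · simp only [if_true] at hx
    subst hx
    exact upperEst_mem hT h0 h1 hacc

/-- For accurate histories the estimated tail probabilities are upper bounds. -/
theorem Accurate.tailEst_true (hD : IsDist D) {T : ℕ} (hT : 0 < T) {h : List (Transcript n k)}
    (hh : Accurate D (Nat.clog 2 (k * n * T)) h) (i : Fin n) (c : Fin k) :
    T * tail D i c ≤ tailEst true T h i c ∧ tailEst true T h i c ≤
      T * (tail D i c + estError T (Nat.clog 2 (k * n * T)) (probeCount i c h)) := by
  have he := estError_nonneg T (Nat.clog 2 (k * n * T)) (probeCount i c h)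
  have hT' : (0 : ℝ) < T := by exact_mod_cast hT
  unfold tailEst
  simp only [if_true]
  split_ifs with h0 h1
  · rw [tail_eq_one hD i h0]
    exact ⟨by linarith, by nlinarith⟩
  · have := c.2
    omega
  · constructor
    -- Every relevant j ≤ c bounds the tail at j, which is at least the tail at c. For the error
    -- bound below, the index c itself is relevant.
    · refine le_runningMin (mul_le_of_le_one_right hT'.le (tail_le_one hD i c)) fun j hj hrel => ?_
      rw [relevant_ne_zero, if_pos rfl] at hrel
      refine le_trans ?_ (hh.bitEst_mem hD hT true i ⟨j, hj⟩ rfl).1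
      exact mul_le_mul_of_nonneg_left (tail_anti hD i (Fin.le_def.2 hrel.2)) hT'.le
    · refine le_trans ?_ (hh.bitEst_mem hD hT true i c rfl).2
      exact_mod_cast runningMin_le_of_rel c.2 (relevant_ne_zero.2 ⟨by omega, by simp⟩)

/-- For accurate histories the estimated tail probabilities are lower bounds. -/
theorem Accurate.tailEst_false (hD : IsDist D) {T : ℕ} (hT : 0 < T) {h : List (Transcript n k)}
    (hh : Accurate D (Nat.clog 2 (k * n * T)) h) (i : Fin n) (c : Fin k) :
    T * (tail D i c - estError T (Nat.clog 2 (k * n * T)) (probeCount i c h)) ≤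
      tailEst false T h i c ∧ tailEst false T h i c ≤ T * tail D i c := by
  have he := estError_nonneg T (Nat.clog 2 (k * n * T)) (probeCount i c h)
  have hT' : (0 : ℝ) < T := by exact_mod_cast hT
  unfold tailEst
  simp only [Bool.false_eq_true, if_false]
  split_ifs with h0 h1
  · rw [tail_eq_one hD i h0]
    exact ⟨by nlinarith, by linarith⟩
  · have := c.2
    omega
  · rw [Nat.cast_sub (runningMin_le _ _ _ _)]
    constructor
    · have h2 := (hh.bitEst_mem hD hT false i c rfl).2
      have h3 : (runningMin T (relevant false c) (bitEst false T h i) k : ℝ) ≤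
          bitEst false T h i c := by
        exact_mod_cast runningMin_le_of_rel c.2 (relevant_ne_zero.2 ⟨by omega, by simp⟩)
      simp only [Bool.false_eq_true, if_false] at h2
      linarith
    · have h2 : T * (1 - tail D i c) ≤
          (runningMin T (relevant false c) (bitEst false T h i) k : ℝ) := by
        refine le_runningMin (mul_le_of_le_one_right hT'.le (by linarith [tail_nonneg hD i c]))
          fun j hj hrel => ?_
        rw [relevant_ne_zero] at hrel
        simp only [Bool.false_eq_true, if_false] at hrel
        refine le_trans ?_ (hh.bitEst_mem hD hT false i ⟨j, hj⟩ rfl).1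
        simp only [Bool.false_eq_true, if_false]
        have := tail_anti hD i (c := c) (d := ⟨j, hj⟩) (Fin.le_def.2 hrel.2)
        exact mul_le_mul_of_nonneg_left (by linarith) hT'.le
      linarith

/-- For accurate histories the learned tail probabilities are close to the true ones. -/
theorem Accurate.abs_tail_sub_le (hD : IsDist D) {T : ℕ} (hT : 0 < T) {h : List (Transcript n k)}
    (hh : Accurate D (Nat.clog 2 (k * n * T)) h) (dir : Bool) (i : Fin n) (c : Fin k) :
    |tail D i c - tail (ofWeights (learnedWeights dir T h)) i c| ≤
      estError T (Nat.clog 2 (k * n * T)) (probeCount i c h) := by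
  have he := estError_nonneg T (Nat.clog 2 (k * n * T)) (probeCount i c h)
  have hT' : (0 : ℝ) < T := by exact_mod_cast hT
  rw [tail_learnedWeights, abs_le]
  cases dir
  · obtain ⟨h1, h2⟩ := hh.tailEst_false hD hT i c
    rw [mul_comm, ← le_div_iff₀ hT'] at h1
    rw [mul_comm, ← div_le_iff₀ hT'] at h2
    exact ⟨by linarith, by linarith⟩
  · obtain ⟨h1, h2⟩ := hh.tailEst_true hD hT i c
    rw [mul_comm, ← le_div_iff₀ hT'] at h1
    rw [mul_comm, ← div_le_iff₀ hT'] at h2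
    exact ⟨by linarith, by linarith⟩

/-- Domination quantifies over real r, but the support values that are at least r form an upper set
of indices: either it starts at some c, or it is empty and both sides are 0. -/
theorem Instance.dominates_of_tail_le (I : Instance) {E D : Fin I.n → Fin I.k → ℝ}
    (h : ∀ i c, tail D i c ≤ tail E i c) : I.Dominates E D := by
  intro i r
  by_cases hr : ∃ j, r ≤ I.a j
  · obtain ⟨c, hc, hmin⟩ := (wellFounded_lt (α := Fin I.k)).has_min {j | r ≤ I.a j} hr
    have hiff : ∀ j, r ≤ I.a j ↔ c ≤ j := fun j =>
      ⟨fun hj => not_lt.1 (hmin j hj), fun hj => le_trans hc (I.a_strictMono.monotone hj)⟩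
    simp only [hiff]
    exact h i c
  · push Not at hr
    simp [fun j => not_le.2 (hr j)]

theorem Accurate.dominates (I : Instance) {D : Fin I.n → Fin I.k → ℝ} (hD : IsDist D) {T : ℕ}
    (hT : 0 < T) {h : List (Transcript I.n I.k)}
    (hh : Accurate D (Nat.clog 2 (I.k * I.n * T)) h) :
    I.Dominates (ofWeights (learnedWeights true T h)) D ∧
      I.Dominates D (ofWeights (learnedWeights false T h)) := by
  have hT' : (0 : ℝ) < T := by exact_mod_cast hT
  constructor <;> refine I.dominates_of_tail_le fun i c => ?_ <;> rw [tail_learnedWeights]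
  · rw [le_div_iff₀ hT', mul_comm]
    exact (hh.tailEst_true hD hT i c).1
  · rw [div_le_iff₀ hT', mul_comm]
    exact (hh.tailEst_false hD hT i c).2

/-! ## Summing the errors -/

/-- Both 1/√N and √(N+1) - √N are of the same order, so the error is charged to the increment of a
square root, which telescopes. For N = 0 the trivial error 1 is below 26√L. -/
theorem estError_le {T L N : ℕ} (hL : 1 ≤ L) (hN : N ≤ T) :
    estError T L N ≤ 26 * √L * (√(N + 1 : ℕ) - √N) := by
  have hl : 1 ≤ √(L : ℝ) := Real.one_le_sqrt.2 (by exact_mod_cast hL)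
  unfold estError
  split_ifs with h0
  · subst h0
    simp
    linarith
  · have hN1 : (1 : ℝ) ≤ N := by exact_mod_cast Nat.one_le_iff_ne_zero.2 h0
    have hNT : (N : ℝ) ≤ T := by exact_mod_cast hN
    set a := √(N : ℝ) with ha
    set b := √((N + 1 : ℕ) : ℝ) with hb
    set l := √(L : ℝ) with hl'
    have ha1 : 1 ≤ a := Real.one_le_sqrt.2 hN1
    have ha2 : a ^ 2 = N := Real.sq_sqrt (by positivity)
    have hb2 : b ^ 2 = N + 1 := by
      rw [hb, Real.sq_sqrt (by positivity)]; push_cast; ring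
    have hb0 : 0 ≤ b := Real.sqrt_nonneg _
    -- √8 is rounded up to 3, and the summand 1 of the radius is absorbed by √L·√N ≥ 1.
    have hR : (radius L N : ℝ) ≤ 4 * l * a := by
      have h1 : (Nat.sqrt (8 * L * N) : ℝ) ≤ 3 * l * a := by
        refine Real.nat_sqrt_le_real_sqrt.trans ((Real.sqrt_le_sqrt ?_).trans_eq
          (Real.sqrt_sq (by positivity : 0 ≤ 3 * l * a)))
        have : (3 * l * a) ^ 2 = 9 * L * N := by
          rw [mul_pow, mul_pow, ha2, hl', Real.sq_sqrt (by positivity)]; norm_num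
        rw [this]
        push_cast
        have : (0 : ℝ) ≤ L * N := by positivity
        nlinarith
      have : 1 ≤ l * a := one_le_mul_of_one_le_of_one_le hl ha1
      unfold radius
      push_cast
      linarith
    have hba : b ≤ 3 / 2 * a := abs_le_of_sq_le_sq' (by nlinarith) (by positivity) |>.2
    have hprod : (b - a) * (b + a) = 1 := by nlinarith
    -- From b ≤ 3a/2 one gets a(b - a) = a/(a + b) ≥ 2/5, so any constant from 22.5 on would do in
    -- place of 26.
    have hkey : 9 ≤ 26 * (a * (b - a)) := by
      have h1 : 0 < b + a := by linarith
      have h2 : b - a = 1 / (b + a) := by rw [eq_div_iff h1.ne', hprod]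
      rw [h2, mul_one_div, ← mul_div_assoc, le_div_iff₀ h1]
      linarith
    have hN' : (0 : ℝ) < N := by linarith
    calc 2 * (radius L N : ℝ) / N + 1 / T ≤ 2 * (4 * l * a) / N + 1 / N := by gcongr
      _ = (8 * l * a + 1) / a ^ 2 := by rw [ha2]; ring
      _ ≤ (9 * l * a) / a ^ 2 := by
          gcongr
          nlinarith [one_le_mul_of_one_le_of_one_le hl ha1]
      _ = 9 * (l / a) := by
          field_simp
      _ ≤ 26 * (a * (b - a)) * (l / a) := by gcongr
      _ = 26 * l * (b - a) := by
          field_simp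

/-- Potential that grows in each period by at least the errors of the probes of that period. -/
noncomputable def potential (L : ℕ) (h : List (Transcript n k)) : ℝ :=
  ∑ i : Fin n, ∑ c : Fin k, 26 * √L * √(probeCount i c h)

/-- A pair is probed at most once per period, so its count moves from N to N or N + 1, and
`estError_le` matches the increment of its square root. -/
theorem sum_estError_le {T L m : ℕ} (hL : 1 ≤ L) (hm : m ≤ T) {h : List (Transcript n k)}
    (hh : IsHistory m h) {s : Transcript n k} (hs : (s.map Prod.fst).Nodup) :
    (s.map fun r => estError T L (probeCount r.1 r.2.1 h)).sum ≤
      potential L (s :: h) - potential L h := by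
  rw [sum_map_eq_sum_probeCountIn fun i c => estError T L (probeCount i c h)]
  simp only [potential, ← Finset.sum_sub_distrib]
  refine Finset.sum_le_sum fun i _ => Finset.sum_le_sum fun c _ => ?_
  rw [probeCount_cons]
  have h1 := probeCountIn_le_one hs i c
  rcases Nat.le_one_iff_eq_zero_or_eq_one.1 h1 with h1 | h1
  · simp [h1]
  · have := estError_le hL ((probeCount_le hh i c).trans hm)
    rw [h1, add_comm 1]
    simp only [Nat.cast_one, one_mul]
    linarith

/-- Cauchy–Schwarz over the nk pairs, whose counts sum to at most nm: (Σ √N)² ≤ nk · nm. -/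
theorem potential_le {L m : ℕ} {h : List (Transcript n k)} (hh : IsHistory m h) :
    potential L h ≤ 26 * √L * (n * √(k * m)) := by
  simp only [potential, ← Finset.mul_sum]
  refine mul_le_mul_of_nonneg_left ?_ (by positivity)
  have h1 : ∑ i : Fin n, ∑ c : Fin k, √(probeCount i c h : ℝ) =
      ∑ q : Fin n × Fin k, √(probeCount q.1 q.2 h : ℝ) := by rw [Fintype.sum_prod_type]
  have h2 : ∑ i : Fin n, ∑ c : Fin k, (probeCount i c h : ℝ) =
      ∑ q : Fin n × Fin k, (probeCount q.1 q.2 h : ℝ) := by rw [Fintype.sum_prod_type]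
  rw [h1]
  have hcs := sq_sum_le_card_mul_sum_sq (s := (Finset.univ : Finset (Fin n × Fin k)))
    (f := fun q => √(probeCount q.1 q.2 h : ℝ))
  simp only [Real.sq_sqrt (Nat.cast_nonneg _), Finset.card_univ, Fintype.card_prod,
    Fintype.card_fin] at hcs
  refine abs_le_of_sq_le_sq' ?_ (by positivity) |>.2
  refine hcs.trans ?_
  rw [← h2, mul_pow, Real.sq_sqrt (by positivity)]
  calc ((n * k : ℕ) : ℝ) * ∑ i : Fin n, ∑ c : Fin k, (probeCount i c h : ℝ)
      ≤ ((n * k : ℕ) : ℝ) * (n * m) := by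
        gcongr
        exact sum_probeCount_le hh
    _ = n ^ 2 * (k * m) := by push_cast; ring

/-- The expected sum of the errors over all periods. -/
theorem sum_histExpect_estError_le {rule : List (Transcript n k) → DTree n k} (hD : IsDist D)
    (hrule : ∀ h, (rule h).NoRepeat ∅) {T L : ℕ} (hL : 1 ≤ L) :
    ∑ t ∈ Finset.range T, histExpect D rule t (fun h => (rule h).expect (tail D)
      fun s => (s.map fun r => estError T L (probeCount r.1 r.2.1 h)).sum) ≤
      26 * √L * (n * √(k * T)) := by
  have step : ∀ t < T, histExpect D rule t (fun h => (rule h).expect (tail D)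
      fun s => (s.map fun r => estError T L (probeCount r.1 r.2.1 h)).sum) ≤
      histExpect D rule (t + 1) (potential L) - histExpect D rule t (potential L) := by
    intro t ht
    rw [le_sub_iff_add_le, ← histExpect_add]
    refine histExpect_mono hD hrule t fun h hh => ?_
    rw [← (hrule h).sum_prob_transcript hD, ← one_mul (potential L h), ← sum_prob hD,
      Finset.sum_mul, ← Finset.sum_add_distrib]
    refine Finset.sum_le_sum fun x _ => ?_
    rw [← mul_add]
    refine mul_le_mul_of_nonneg_left ?_ (prob_nonneg hD x)
    have := sum_estError_le hL ht.le hh ((hrule h).nodup_transcript x)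
    linarith
  calc _ ≤ ∑ t ∈ Finset.range T,
        (histExpect D rule (t + 1) (potential L) - histExpect D rule t (potential L)) :=
        Finset.sum_le_sum fun t ht => step t (Finset.mem_range.1 ht)
    _ = histExpect D rule T (potential L) - histExpect D rule 0 (potential L) :=
        Finset.sum_range_sub (fun t => histExpect D rule t (potential L)) T
    _ ≤ histExpect D rule T (potential L) := by
        have : 0 ≤ histExpect D rule 0 (potential (n := n) (k := k) L) := by
          unfold histExpect potential; positivity
        linarith
    _ ≤ histExpect D rule T fun _ => 26 * √L * (n * √(k * T)) :=
        histExpect_mono hD hrule T fun h hh => potential_le hh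
    _ = _ := histExpect_const hD T _

end Estimates

/-! ## The value of a policy as a function of its leaf -/

namespace Instance

variable (I : Instance)

theorem value_nonneg (σ : DTree I.n I.k) (x : Realization I.n I.k) : 0 ≤ I.value σ x :=
  I.cost_nonneg _ _

/-- Feasible policies probe at most n pairs, so only finitely many arguments of the cost occur.
Boundedness is what makes the real supremum `fMax` an upper bound. -/
theorem bddAbove_value :
    BddAbove (Set.range fun p : I.feasible × Realization I.n I.k => I.value p.1 p.2) := by
  have hfin : Set.Finite ((fun q : List (Fin I.n × Fin I.k) × Realization I.n I.k =>
      I.cost q.1 q.2) '' ({S | S.length ≤ I.n} ×ˢ Set.univ)) :=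
    ((List.finite_length_le _ _).prod Set.finite_univ).image _
  refine hfin.bddAbove.mono ?_
  rintro _ ⟨⟨⟨σ, hσ⟩, x⟩, rfl⟩
  refine ⟨(σ.probes x, x), ⟨?_, Set.mem_univ _⟩, rfl⟩
  simp only [Set.mem_ofPred_eq, DTree.probes, List.length_map]
  exact length_le_of_nodup_items ((I.feasible_noRepeat σ hσ).nodup_transcript x)

theorem value_le_fMax {σ : DTree I.n I.k} (hσ : σ ∈ I.feasible) (x : Realization I.n I.k) :
    I.value σ x ≤ I.fMax :=
  le_ciSup I.bddAbove_value (⟨σ, hσ⟩, x)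

theorem fMax_nonneg : 0 ≤ I.fMax := Real.iSup_nonneg fun _ => I.value_nonneg _ _

-- Leaf constancy lets the value be read off the transcript. Unreachable transcripts receive 0, so
-- that the bounds hold for all transcripts, as the tree estimates require.
open Classical in
theorem LeafConstant.exists_leafValue {I : Instance} (hI : I.LeafConstant) {σ : DTree I.n I.k}
    (hσ : σ ∈ I.feasible) :
    ∃ F : Transcript I.n I.k → ℝ, (∀ s, 0 ≤ F s) ∧ (∀ s, F s ≤ I.fMax) ∧
      ∀ x, I.value σ x = F (σ.transcript x) := by
  refine ⟨fun s => if h : ∃ x, σ.transcript x = s then I.value σ h.choose else 0,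
    fun s => ?_, fun s => ?_, fun x => ?_⟩
  · dsimp only
    split_ifs
    exacts [I.value_nonneg _ _, le_rfl]
  · dsimp only
    split_ifs
    exacts [I.value_le_fMax hσ _, I.fMax_nonneg]
  · have h : ∃ y, σ.transcript y = σ.transcript x := ⟨x, rfl⟩
    dsimp only
    rw [dif_pos h]
    exact hI σ hσ _ _ h.choose_spec.symm

variable {I} {D E : Fin I.n → Fin I.k → ℝ}

theorem expValue_nonneg (hD : IsDist D) (σ : DTree I.n I.k) : 0 ≤ I.expValue D σ :=
  Finset.sum_nonneg fun x _ => mul_nonneg (prob_nonneg hD x) (I.value_nonneg σ x)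

theorem expValue_le_fMax (hD : IsDist D) {σ : DTree I.n I.k} (hσ : σ ∈ I.feasible) :
    I.expValue D σ ≤ I.fMax := by
  rw [← one_mul I.fMax, ← sum_prob hD, Finset.sum_mul]
  exact Finset.sum_le_sum fun x _ =>
    mul_le_mul_of_nonneg_left (I.value_le_fMax hσ x) (prob_nonneg hD x)

theorem opt_nonneg (hD : IsDist D) (s : Sense) : 0 ≤ I.opt D s := by
  cases s
  · exact Real.iInf_nonneg fun σ => expValue_nonneg hD _
  · exact Real.iSup_nonneg fun σ => expValue_nonneg hD _

theorem opt_maximize_le_fMax (hD : IsDist D) : I.opt D .maximize ≤ I.fMax :=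
  have := I.feasible_nonempty.to_subtype
  ciSup_le fun σ => expValue_le_fMax hD σ.2

/-- The values of a policy under two families of distributions differ by at most the expected sum
of the differences of the tail probabilities of its probes. -/
theorem LeafConstant.abs_expValue_sub_le (hI : I.LeafConstant) (hD : IsDist D) (hE : IsDist E)
    {σ : DTree I.n I.k} (hσ : σ ∈ I.feasible) :
    |I.expValue D σ - I.expValue E σ| ≤ I.fMax * σ.expect (tail D) fun s =>
      (s.map fun r => |tail D r.1 r.2.1 - tail E r.1 r.2.1|).sum := by
  obtain ⟨F, hF0, hF1, hF⟩ := hI.exists_leafValue hσ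
  have hnr := I.feasible_noRepeat σ hσ
  simp only [expValue, hF]
  rw [hnr.sum_prob_transcript hD, hnr.sum_prob_transcript hE]
  exact σ.abs_expect_sub_le (tail_nonneg hD) (tail_le_one hD) (tail_nonneg hE) (tail_le_one hE)
    hF0 hF1

theorem isHistory_history {rule : List (Transcript I.n I.k) → DTree I.n I.k}
    (hrule : ∀ h, (rule h).NoRepeat ∅) (xs : List (Realization I.n I.k)) :
    IsHistory xs.length (I.history rule xs) := by
  induction xs with
  | nil => exact ⟨rfl, by simp [history]⟩
  | cons x xs ih => exact ih.cons (hrule _) x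

end Instance

/-! ## Optimism -/

namespace ThresholdProblem

variable (P : ThresholdProblem)

/-- The shortfall of a policy with respect to the benchmark. -/
noncomputable def loss (I : P.Inst) (α : ℝ) (D : Fin (P.inst I).n → Fin (P.inst I).k → ℝ)
    (σ : DTree (P.inst I).n (P.inst I).k) : ℝ :=
  match P.sense with
  | .minimize => (P.inst I).expValue D σ - α * (P.inst I).opt D .minimize
  | .maximize => α * (P.inst I).opt D .maximize - (P.inst I).expValue D σ

/-- The optimal value under `E` is at least as good as that under `D`. -/
def Better (I : P.Inst) (E D : Fin (P.inst I).n → Fin (P.inst I).k → ℝ) : Prop :=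
  match P.sense with
  | .minimize => (P.inst I).opt E .minimize ≤ (P.inst I).opt D .minimize
  | .maximize => (P.inst I).opt D .maximize ≤ (P.inst I).opt E .maximize

/-- For monotone problems, overestimation or underestimation is optimistic. -/
theorem exists_optimistic (hP : P.UpMonotone ∨ P.DownMonotone) :
    ∃ dir : Bool, ∀ (I : P.Inst) (D E : Fin (P.inst I).n → Fin (P.inst I).k → ℝ),
      IsDist D → IsDist E →
      (if dir then (P.inst I).Dominates E D else (P.inst I).Dominates D E) → P.Better I E D := by
  unfold Better
  -- Overestimates are optimistic for minimization with up-monotonicity and for maximization with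
  -- down-monotonicity, underestimates in the two other cases.
  rcases hP with hP | hP <;> [unfold UpMonotone at hP; unfold DownMonotone at hP] <;> cases hs : P.sense <;>
    simp only [hs] at hP ⊢
  · exact ⟨true, fun I D E hD hE h => hP I D E hD hE h⟩
  · exact ⟨false, fun I D E hD hE h => hP I E D hE hD (by simpa using h)⟩
  · exact ⟨false, fun I D E hD hE h => hP I E D hE hD (by simpa using h)⟩
  · exact ⟨true, fun I D E hD hE h => hP I D E hD hE h⟩

variable {P} {I : P.Inst} {α : ℝ} {D E : Fin (P.inst I).n → Fin (P.inst I).k → ℝ}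
  {σ : DTree (P.inst I).n (P.inst I).k}

/-- The crude bound for inaccurate histories. For minimization the benchmark is non-negative; for
maximization α ≤ 1 keeps it below f_max. -/
theorem loss_le_fMax (hα : P.IsRatio α) (hD : IsDist D) (hσ : σ ∈ (P.inst I).feasible) :
    P.loss I α D σ ≤ (P.inst I).fMax := by
  unfold loss
  unfold IsRatio at hα
  have h1 := Instance.expValue_nonneg hD σ
  have h2 := Instance.expValue_le_fMax hD hσ
  cases hs : P.sense <;> simp only [hs] at hα ⊢
  · have := mul_nonneg (zero_le_one.trans hα) (Instance.opt_nonneg hD .minimize)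
    linarith
  · have h3 := Instance.opt_maximize_le_fMax hD
    have h4 := mul_le_of_le_one_left (Instance.opt_nonneg hD .maximize) hα.2
    linarith

/-- For minimization, f(σ|E) ≤ α OPT(E) ≤ α OPT(D); for maximization the inequalities are reversed.
Since the guarantee is used under E and the benchmarks are compared afterwards, the estimation error
is not multiplied by α. -/
theorem loss_le_of_better (hα : P.IsRatio α) (hσ : P.IsApprox I α E σ) (h : P.Better I E D) :
    P.loss I α D σ ≤ |(P.inst I).expValue D σ - (P.inst I).expValue E σ| := by
  unfold loss
  unfold IsRatio at hα
  unfold IsApprox at hσ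
  unfold Better at h
  cases hs : P.sense <;> simp only [hs] at hα hσ h ⊢
  · refine le_trans ?_ (le_abs_self _)
    have := mul_le_mul_of_nonneg_left h (zero_le_one.trans hα)
    linarith
  · refine le_trans ?_ (neg_le_abs _)
    have := mul_le_mul_of_nonneg_left h hα.1
    linarith

theorem regret_eq_sum_loss (hD : IsDist D)
    (rule : List (Transcript (P.inst I).n (P.inst I).k) → DTree (P.inst I).n (P.inst I).k)
    (T : ℕ) : (P.inst I).regret P.sense α rule T D =
      ∑ t ∈ Finset.range T, histExpect D rule t fun h => P.loss I α D (rule h) := by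
  unfold loss Instance.regret
  cases P.sense <;>
    simp only [Instance.expTotal_eq_sum _ hD, sub_eq_add_neg, histExpect_add,
      histExpect_const hD, Finset.sum_add_distrib, Finset.sum_const, Finset.card_range,
      nsmul_eq_mul, ← neg_one_mul (Instance.expValue _ _ _), histExpect_const_mul,
      ← Finset.mul_sum] <;> ring

/-- The learning rule follows the offline algorithm for the learned distributions. -/
structure IsOptimisticRule (P : ThresholdProblem) (I : P.Inst) (α : ℝ) (dir : Bool) (T : ℕ)
    (rule : List (Transcript (P.inst I).n (P.inst I).k) → DTree (P.inst I).n (P.inst I).k) :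
    Prop where
  noRepeat : ∀ h, (rule h).NoRepeat ∅
  mem : ∀ h, (∀ i, 0 < ∑ j, learnedWeights dir T h i j) → rule h ∈ (P.inst I).feasible
  approx : ∀ h, (∀ i, 0 < ∑ j, learnedWeights dir T h i j) →
    P.IsApprox I α (ofWeights (learnedWeights dir T h)) (rule h)

variable {dir : Bool} {T : ℕ}
  {rule : List (Transcript (P.inst I).n (P.inst I).k) → DTree (P.inst I).n (P.inst I).k}

-- On accurate histories the loss of a period is at most f_max times the expected errors of its
-- probes; on the others it is at most f_max. Their total probability over all periods is at most 2,
-- whence the additive term.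
open Classical in
theorem IsOptimisticRule.regret_le (hα : P.IsRatio α)
    (hdir : ∀ (D E : Fin (P.inst I).n → Fin (P.inst I).k → ℝ), IsDist D → IsDist E →
      (if dir then (P.inst I).Dominates E D else (P.inst I).Dominates D E) → P.Better I E D)
    (hleaf : (P.inst I).LeafConstant) (hrule : IsOptimisticRule P I α dir T rule)
    (hD : IsDist D) (hT : 0 < T) (hn : 0 < (P.inst I).n) (hk : 2 ≤ (P.inst I).k) :
    (P.inst I).regret P.sense α rule T D ≤
      (P.inst I).fMax * (2 + 26 * √(Nat.clog 2 ((P.inst I).k * (P.inst I).n * T)) *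
        ((P.inst I).n * √((P.inst I).k * T))) := by
  set M := (P.inst I).k * (P.inst I).n * T with hM
  set L := Nat.clog 2 M with hL
  have hTM : T ≤ M := Nat.le_mul_of_pos_left _ (Nat.mul_pos (by omega) hn)
  have hM2 : 2 ≤ M := by
    calc 2 = 2 * 1 * 1 := rfl
      _ ≤ M := Nat.mul_le_mul (Nat.mul_le_mul hk hn) hT
  have hL1 : 1 ≤ L := Nat.clog_pos one_lt_two hM2
  have hpos : ∀ (h : List (Transcript (P.inst I).n (P.inst I).k)) i,
      0 < ∑ j, learnedWeights dir T h i j := fun h i => by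
    rw [sum_learnedWeights _ _ _ _ (by omega)]; exact hT
  have hloss : ∀ h, P.loss I α D (rule h) ≤ (P.inst I).fMax * ((if Accurate D L h then 0 else 1) +
      (rule h).expect (tail D)
        fun s => (s.map fun r => estError T L (probeCount r.1 r.2.1 h)).sum) := by
    intro h
    have hE := isDist_ofWeights (hpos h)
    have hmono : (rule h).expect (tail D) (fun _ => 0) ≤ (rule h).expect (tail D)
        fun s => (s.map fun r => estError T L (probeCount r.1 r.2.1 h)).sum :=
      (rule h).expect_mono (tail_nonneg hD) (tail_le_one hD) fun s => List.sum_nonneg fun a ha => by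
        obtain ⟨r, -, rfl⟩ := List.mem_map.1 ha
        exact estError_nonneg _ _ _
    rw [DTree.expect_const] at hmono
    split_ifs with hacc
    · rw [zero_add]
      have hdom := hacc.dominates _ hD hT
      refine (loss_le_of_better hα (hrule.approx h (hpos h)) (hdir D _ hD hE ?_)).trans
        ((hleaf.abs_expValue_sub_le hD hE (hrule.mem h (hpos h))).trans
          (mul_le_mul_of_nonneg_left ((rule h).expect_mono (tail_nonneg hD) (tail_le_one hD)
            fun s => List.sum_le_sum fun r _ => hacc.abs_tail_sub_le hD hT dir r.1 r.2.1)
            (P.inst I).fMax_nonneg))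
      cases dir
      · simpa using hdom.2
      · simpa using hdom.1
    · refine (loss_le_fMax hα hD (hrule.mem h (hpos h))).trans
        (le_mul_of_one_le_right (P.inst I).fMax_nonneg (by linarith))
  -- L is a base-2 logarithm rounded up, so M ≤ 2^L ≤ e^L.
  have hexp : (M : ℝ) * Real.exp (-L) ≤ 1 := by
    have h1 : (M : ℝ) ≤ 2 ^ L := by exact_mod_cast Nat.le_pow_clog one_lt_two M
    have h2 : (2 : ℝ) ^ L ≤ Real.exp L := by
      rw [← mul_one (L : ℝ), Real.exp_nat_mul]
      exact pow_le_pow_left₀ zero_le_two (by linarith [Real.add_one_le_exp (1 : ℝ)]) _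
    rw [Real.exp_neg, ← div_eq_mul_inv, div_le_one (Real.exp_pos _)]
    exact h1.trans h2
  have hbad : ∑ t ∈ Finset.range T, histExpect D rule t (fun h => if Accurate D L h then 0 else 1) ≤
      2 := by
    calc _ ≤ ∑ t ∈ Finset.range T,
          2 * ((P.inst I).k * (P.inst I).n * T) * Real.exp (-(2 * L)) :=
          Finset.sum_le_sum fun t ht =>
            histExpect_not_accurate_le hD hrule.noRepeat (Finset.mem_range.1 ht).le
      _ = T * (2 * M * Real.exp (-(2 * L))) := by
          rw [Finset.sum_const, Finset.card_range, nsmul_eq_mul, hM]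
          push_cast
          ring
      _ ≤ M * (2 * M * Real.exp (-(2 * L))) := by gcongr
      _ = 2 * (M * Real.exp (-L)) ^ 2 := by
          rw [mul_pow, ← Real.exp_nat_mul]
          push_cast
          ring_nf
      _ ≤ 2 := by
          have := pow_le_one₀ (n := 2) (by positivity) hexp
          linarith
  rw [regret_eq_sum_loss hD]
  calc _ ≤ ∑ t ∈ Finset.range T, histExpect D rule t fun h =>
        (P.inst I).fMax * ((if Accurate D L h then 0 else 1) + (rule h).expect (tail D)
          fun s => (s.map fun r => estError T L (probeCount r.1 r.2.1 h)).sum) :=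
        Finset.sum_le_sum fun t _ => histExpect_mono hD hrule.noRepeat t fun h _ => hloss h
    _ ≤ _ := by
        simp only [histExpect_const_mul, histExpect_add, ← Finset.mul_sum, Finset.sum_add_distrib]
        exact mul_le_mul_of_nonneg_left
          (add_le_add hbad (sum_histExpect_estError_le hD hrule.noRepeat hL1))
          (P.inst I).fMax_nonneg

/-- Without items, or with a single support value, nothing has to be learned. -/
theorem IsOptimisticRule.regret_nonpos (hα : P.IsRatio α)
    (hrule : IsOptimisticRule P I α dir T rule) (hD : IsDist D) (hT : 0 < T)
    (hnk : (P.inst I).n = 0 ∨ (P.inst I).k = 1) :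
    (P.inst I).regret P.sense α rule T D ≤ 0 := by
  have hpos : ∀ (h : List (Transcript (P.inst I).n (P.inst I).k)) i,
      0 < ∑ j, learnedWeights dir T h i j := fun h i => by
    rw [sum_learnedWeights _ _ _ _ (by have := i.2; omega)]; exact hT
  -- With no items, or with one support value, there is only one family of distributions, so the
  -- learned one is the true one.
  have heq : ∀ h, ofWeights (learnedWeights dir T h) = D := fun h => by
    have hE := isDist_ofWeights (hpos h)
    funext i j
    have hone : ∀ E : Fin (P.inst I).n → Fin (P.inst I).k → ℝ, IsDist E → E i j = 1 := by
      intro E hE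
      have hk : (P.inst I).k = 1 := hnk.resolve_left (by have := i.2; omega)
      rw [← hE.sum_eq i]
      refine (Fintype.sum_eq_single j fun l hl => (hl (Fin.ext ?_)).elim).symm
      have := l.2
      have := j.2
      omega
    rw [hone _ hE, hone _ hD]
  rw [regret_eq_sum_loss hD]
  refine Finset.sum_nonpos fun t _ => ?_
  refine (histExpect_mono hD hrule.noRepeat t (G := fun _ => 0) fun h _ => ?_).trans_eq
    (histExpect_const hD t 0)
  have hbetter : P.Better I D D := by unfold Better; cases P.sense <;> exact le_rfl
  have := hrule.approx h (hpos h)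
  rw [heq h] at this
  simpa using loss_le_of_better hα this hbetter

/-- From (L - 1) log 2 ≤ log M and log 2 ≤ log M follows L log 2 ≤ 2 log M, and 2 / log 2 < 3. -/
theorem clog_le_three_mul_log {M : ℕ} (hM : 2 ≤ M) : (Nat.clog 2 M : ℝ) ≤ 3 * Real.log M := by
  have h1 : 1 ≤ Nat.clog 2 M := Nat.clog_pos one_lt_two hM
  have h2 : (2 : ℝ) ^ (Nat.clog 2 M - 1) ≤ M := by
    exact_mod_cast (Nat.pow_pred_clog_lt_self one_lt_two (by omega)).le
  have h3 := Real.log_le_log (by positivity) h2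
  rw [Real.log_pow, Nat.cast_sub h1, Nat.cast_one] at h3
  have h4 : Real.log 2 ≤ Real.log M := Real.log_le_log two_pos (by exact_mod_cast hM)
  have h5 := Real.log_two_gt_d9
  have h6 : (1 : ℝ) ≤ Nat.clog 2 M := by exact_mod_cast h1
  nlinarith

/-- For n ≥ 1, k ≥ 2 and T ≥ 1 the quantity n√(kT log(knT)) is at least 1 and absorbs the additive
2. The remaining cases are treated separately because the logarithm can vanish there, as for n = k =
T = 1; k = 0 with n > 0 admits no distributions. -/
theorem IsOptimisticRule.regret_le_sqrt (hα : P.IsRatio α)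
    (hdir : ∀ (D E : Fin (P.inst I).n → Fin (P.inst I).k → ℝ), IsDist D → IsDist E →
      (if dir then (P.inst I).Dominates E D else (P.inst I).Dominates D E) → P.Better I E D)
    (hleaf : (P.inst I).LeafConstant) (hrule : IsOptimisticRule P I α dir T rule)
    (hD : IsDist D) :
    (P.inst I).regret P.sense α rule T D ≤
      50 * ((P.inst I).n * (P.inst I).fMax * √((P.inst I).k * T *
        Real.log ((P.inst I).k * (P.inst I).n * T))) := by
  have hf := (P.inst I).fMax_nonneg
  have hrhs : 0 ≤ 50 * ((P.inst I).n * (P.inst I).fMax * √((P.inst I).k * T *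
        Real.log ((P.inst I).k * (P.inst I).n * T))) := by positivity
  rcases Nat.eq_zero_or_pos T with rfl | hT
  · rw [regret_eq_sum_loss hD]
    simp
  by_cases hnk : (P.inst I).n = 0 ∨ (P.inst I).k = 1
  · exact (hrule.regret_nonpos hα hD hT hnk).trans hrhs
  push Not at hnk
  have hn : 0 < (P.inst I).n := Nat.pos_of_ne_zero hnk.1
  have hk : 2 ≤ (P.inst I).k := by
    have : (P.inst I).k ≠ 0 := fun h0 => by
      have := hD.sum_eq ⟨0, hn⟩
      rw [Finset.sum_eq_zero fun j _ => by have := j.2; omega] at this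
      norm_num at this
    omega
  refine (hrule.regret_le hα hdir hleaf hD hT hn hk).trans ?_
  have hM2 : 2 ≤ (P.inst I).k * (P.inst I).n * T := by
    calc 2 = 2 * 1 * 1 := rfl
      _ ≤ _ := Nat.mul_le_mul (Nat.mul_le_mul hk hn) hT
  have hlog := clog_le_three_mul_log hM2
  have hlog2 : Real.log 2 ≤ Real.log ((P.inst I).k * (P.inst I).n * T : ℕ) :=
    Real.log_le_log two_pos (by exact_mod_cast hM2)
  push_cast at hlog hlog2
  set L := Nat.clog 2 ((P.inst I).k * (P.inst I).n * T)
  set l := Real.log ((P.inst I).k * (P.inst I).n * T)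
  have hl2 := Real.log_two_gt_d9
  have hn1 : (1 : ℝ) ≤ (P.inst I).n := by exact_mod_cast hn
  have hk2 : (2 : ℝ) ≤ (P.inst I).k := by exact_mod_cast hk
  have hT1 : (1 : ℝ) ≤ T := by exact_mod_cast hT
  have hkT : (2 : ℝ) ≤ (P.inst I).k * T := by nlinarith
  set r := √((P.inst I).k * T * l)
  have hr1 : 1 ≤ r := Real.one_le_sqrt.2 (by nlinarith)
  -- 9/5 is a rational bound for √3, from L ≤ 3 log M. The constants then add up to 2 + 26 · 9/5 =
  -- 48.8 ≤ 50.
  have hLr : √L * √((P.inst I).k * T) ≤ 9 / 5 * r := by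
    rw [← Real.sqrt_mul (by positivity)]
    refine Real.sqrt_le_iff.2 ⟨by positivity, ?_⟩
    rw [mul_pow, Real.sq_sqrt (by nlinarith)]
    nlinarith
  calc (P.inst I).fMax * (2 + 26 * √L * ((P.inst I).n * √((P.inst I).k * T)))
      = (P.inst I).fMax * (2 + 26 * (P.inst I).n * (√L * √((P.inst I).k * T))) := by ring
    _ ≤ (P.inst I).fMax * (2 * ((P.inst I).n * r) + 26 * (P.inst I).n * (9 / 5 * r)) := by
        have := one_le_mul_of_one_le_of_one_le hn1 hr1
        gcongr
        linarith
    _ ≤ (P.inst I).fMax * (50 * ((P.inst I).n * r)) := by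
        refine mul_le_mul_of_nonneg_left ?_ hf
        have : 0 ≤ (P.inst I).n * r := by positivity
        linarith
    _ = _ := by ring

open Classical in
/-- An offline approximation algorithm yields a polynomial-time optimistic learner. -/
theorem IsApproxAlgorithm.exists_optimistic_learner {P : ThresholdProblem} {α : ℝ} {alg : Prog}
    (halg : P.IsApproxAlgorithm α alg) (dir : Bool) :
    ∃ (learner : Prog) (rule : P.LearningRule), P.IsPolyTimeLearner learner rule ∧
      ∀ I T, IsOptimisticRule P I α dir T (rule I T) := by
  obtain ⟨b, hb⟩ := halg
  choose σ hσ happrox himpl using hb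
  obtain ⟨learner, c, hc⟩ := LearnerState.exists_learner P dir alg b
  -- The default `leaf` is taken only if n > 0 and T = 0 or k = 0; it need not be feasible, but it
  -- repeats no item.
  let rule : P.LearningRule := fun I T h =>
    if hw : ∀ i, 0 < ∑ j, learnedWeights dir T h i j then σ I (learnedWeights dir T h) hw
    else .leaf
  have hrule : ∀ I T h (hw : ∀ i, 0 < ∑ j, learnedWeights dir T h i j),
      rule I T h = σ I (learnedWeights dir T h) hw := fun I T h hw => dif_pos hw
  have hopt : ∀ I T, IsOptimisticRule P I α dir T (rule I T) := fun I T =>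
    { noRepeat := fun h => by
        by_cases hw : ∀ i, 0 < ∑ j, learnedWeights dir T h i j
        · rw [hrule I T h hw]
          exact (P.inst I).feasible_noRepeat _ (hσ _ _ _)
        · simp only [rule, dif_neg hw, DTree.NoRepeat]
      mem := fun h hw => by
        rw [hrule I T h hw]
        exact hσ _ _ _
      approx := fun h hw => by
        rw [hrule I T h hw]
        exact happrox _ _ _ }
  refine ⟨learner, rule, ⟨c, fun I T xs t => ?_⟩, hopt⟩
  set h := (P.inst I).historyBefore (rule I T) xs t with hh
  -- A period t below T forces T > 0, and an item with a realized value forces k > 0, so the default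
  -- never occurs in an actual period.
  have hw : ∀ i, 0 < ∑ j, learnedWeights dir T h i j := fun i => by
    rw [sum_learnedWeights _ _ _ _ (by have := (xs t i).2; omega)]
    exact t.pos
  have hhist := Instance.isHistory_history (hopt I T).noRepeat ((List.ofFn xs).take t).reverse
  refine ⟨(hopt I T).mem h hw, fun x s hs => ?_⟩
  refine hc ⟨I, T, h, s.1, ?_, hhist.2, (((hopt I T).noRepeat h).nodup_of_mem_trace hs).1⟩ _ ?_
  · have := hhist.1
    rw [← Instance.historyBefore, ← hh] at this
    rw [this]
    simp
  · rw [hrule I T h hw] at hs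
    exact himpl I _ hw x s hs

end ThresholdProblem

end BinaryFeedback

theorem theorem4p2 :
    ∃ C : ℝ, 0 < C ∧
      ∀ (P : ThresholdProblem) (α : ℝ),
        P.IsRatio α →
        (P.UpMonotone ∨ P.DownMonotone) →
        P.LeafConstant →
        (∃ alg : Prog, P.IsApproxAlgorithm α alg) →
        ∃ (learner : Prog) (rule : P.LearningRule),
          P.IsPolyTimeLearner learner rule ∧
          ∀ (I : P.Inst) (T : ℕ) (D : Fin (P.inst I).n → Fin (P.inst I).k → ℝ),
            IsDist D →
            (P.inst I).regret P.sense α (rule I T) T D ≤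
              C * ((P.inst I).n * (P.inst I).fMax *
                Real.sqrt ((P.inst I).k * T *
                  Real.log ((P.inst I).k * (P.inst I).n * T))) := by
  refine ⟨50, by norm_num, fun P α hα hmono hleaf ⟨alg, halg⟩ => ?_⟩
  obtain ⟨dir, hdir⟩ := P.exists_optimistic hmono
  obtain ⟨learner, rule, hpoly, hopt⟩ := halg.exists_optimistic_learner dir
  exact ⟨learner, rule, hpoly, fun I T D hD =>
    (hopt I T).regret_le_sqrt hα (hdir I) (hleaf I) hD⟩
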